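/- Fix $k\in\mathbb N$ and a finite alphabet $\Sigma$, let $1\notin\Sigma$ be a separator and $\Sigma_1=\Sigma\cup\{1\}$; the rank of a word over $\Sigma_1$ is its number of separators, and $x\odot_j y$ denotes the result of replacing the $j$-th separator of $x$ by $y$. Let $N$ be a finite set of nonterminals with ranks in $\{0,\dots,k\}$. The $k$-correct terms are: nonterminals (with their rank), words over $\Sigma$ (rank $0$), the separator $1$ (rank $1$), $\alpha\cdot\beta$ of rank $\mathrm{rk}(\alpha)+\mathrm{rk}(\beta)$ for $k$-correct $\alpha,\beta$ with $\mathrm{rk}(\alpha)+\mathrm{rk}(\beta)\le k$, and $\alpha\odot_j\beta$ of rank $\mathrm{rk}(\alpha)+\mathrm{rk}(\beta)-1$ for $k$-correct $\alpha,\beta$ with $1\le j\le k$, $j\le\mathrm{rk}(\alpha)$ and $\mathrm{rk}(\alpha)+\mathrm{rk}(\beta)\le k+1$. A $k$-DCFG over $\Sigma$ is a quadruple $G=\langle N,\Sigma,P,S\rangle$ with $S\in N$ of rank $0$ and a finite set $P$ of rules $A\to\alpha$, where $A\in N$ and $\alpha$ is a $k$-correct term with $\mathrm{rk}(\alpha)=\mathrm{rk}(A)$.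 Its language $L(G)$ is the set of values of the terms without nonterminals that are derivable from $S$ by replacing occurrences of nonterminals according to the rules; two $k$-DCFGs are equivalent if their languages are equal. $G$ is in Chomsky normal form if each of its rules is of the form $A\to B\cdot C$ or $A\to B\odot_j C$ with $B,C\in N\setminus\{S\}$, or $A\to a$ with $a\in\Sigma_1$, or $S\to\varepsilon$. A derivation tree of $w\in L(G)$ in such a grammar is the syntactic tree of a term with value $w$ that is derived from $S$, each of its nodes being labelled with the nonterminal to which a rule was applied there; in particular, a leaf is a single node, carrying both a letter of $\Sigma_1$ (or $\varepsilon$) and the nonterminal that was rewritten to it. The rank of a node is the rank of its label. Let $N_l$ be the number of nonterminals of rank $l$. An $l$-matryoshka is a contiguous part of a branch that consists of at least $N_l+1$ nodes, all of rank $l$. A path of the tree (regarded as an undirected graph) is $l$-heavy if all its nodes have rank at least $l$. A $k$-DCFG in Chomsky normal form is $m$-compact if every $w\in L(G)$ has a derivation tree $T_w$ such that for every node $v$ of $T_w$ of positive rank $l$ there are $l'\ge l$ and an element $v'$ of an $l'$-matryoshka of $T_w$ such that $v$ and $v'$ are connected by an $l$-heavy path of length at most $m$. **Theorem.** For every $k$-DCFG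 $G$ there are a natural number $m$ and a $k$-DCFG $G'$ over the same alphabet, in Chomsky normal form, such that $G'$ is equivalent to $G$ and $G'$ is $m$-compact. -/

import Mathlib

universe u v

namespace Displacement

/-- Words over the alphabet `T` extended by the separator: `some a` is the letter `a` and
`none` is the distinguished separator `1`. -/
abbrev SepWord (T : Type u) : Type u := List (Option T)

/-- `intercalate j x y` replaces the `j`-th separator of `x` (counted from `1`) by `y`. -/
def intercalate {T : Type u} : ℕ → SepWord T → SepWord T → SepWord T
  | _, [], _ => []
  | j, some a :: x, y => some a :: intercalate j x y
  | j, none :: x, y => if j = 1 then y ++ x else none :: intercalate (j - 1) x y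

/-- Terms over nonterminals `N` and terminals `T`: nonterminals, words without separators, the
separator `1`, concatenations `α · β` and intercalations `α ⊙_j β`. -/
inductive Term (N : Type v) (T : Type u) : Type (max u v)
  | nt (A : N) : Term N T
  | word (w : List T) : Term N T
  | sep : Term N T
  | concat (α β : Term N T) : Term N T
  | wrap (j : ℕ) (α β : Term N T) : Term N T

namespace Term

variable {N : Type v} {T : Type u}

/-- The rank of a term, given the ranks of the nonterminals. -/
def rank (rk : N → ℕ) : Term N T → ℕ
  | nt A => rk A
  | word _ => 0
  | sep => 1
  | concat α β => rank rk α + rank rk β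
  | wrap _ α β => rank rk α + rank rk β - 1

/-- Membership in the set of `k`-correct terms. -/
def Correct (rk : N → ℕ) (k : ℕ) : Term N T → Prop
  | nt A => rk A ≤ k
  | word _ => True
  | sep => True
  | concat α β => Correct rk k α ∧ Correct rk k β ∧ rank rk α + rank rk β ≤ k
  | wrap j α β => Correct rk k α ∧ Correct rk k β ∧ 1 ≤ j ∧ j ≤ k ∧
      rank rk α + rank rk β ≤ k + 1 ∧ j ≤ rank rk α

/-- A term is ground if no nonterminal occurs in it. -/
def Ground : Term N T → Prop
  | nt _ => False
  | word _ => True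
  | sep => True
  | concat α β => Ground α ∧ Ground β
  | wrap _ α β => Ground α ∧ Ground β

/-- The word denoted by a ground term (only used for ground terms). -/
def value : Term N T → SepWord T
  | nt _ => []
  | word w => w.map some
  | sep => [none]
  | concat α β => value α ++ value β
  | wrap j α β => intercalate j (value α) (value β)

end Term

/-- Contexts: terms with exactly one leaf marked as the place of substitution. -/
inductive Context (N : Type v) (T : Type u) : Type (max u v)
  | hole : Context N T
  | concatLeft (C : Context N T) (β : Term N T) : Context N T
  | concatRight (α : Term N T) (C : Context N T) : Context N T
  | wrapLeft (j : ℕ) (C : Context N T) (β : Term N T) : Context N T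
  | wrapRight (j : ℕ) (α : Term N T) (C : Context N T) : Context N T

/-- `C.fill γ` is the term `C[γ]`. -/
def Context.fill {N : Type v} {T : Type u} : Context N T → Term N T → Term N T
  | .hole, γ => γ
  | .concatLeft C β, γ => .concat (C.fill γ) β
  | .concatRight α C, γ => .concat α (C.fill γ)
  | .wrapLeft j C β, γ => .wrap j (C.fill γ) β
  | .wrapRight j α C, γ => .wrap j α (C.fill γ)

/-- A `k`-displacement context-free grammar over the terminal alphabet `T`. The pair `(A, α)` in
`rules` is the rule `A → α`. -/
structure DCFG (T : Type u) (k : ℕ) where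
  /-- the nonterminals -/
  NT : Type v
  finite_NT : Finite NT
  /-- the rank of a nonterminal -/
  rk : NT → ℕ
  rk_le : ∀ A, rk A ≤ k
  /-- the start symbol -/
  start : NT
  rk_start : rk start = 0
  /-- the rules -/
  rules : Set (NT × Term NT T)
  finite_rules : rules.Finite
  correct_rules : ∀ A α, (A, α) ∈ rules → α.Correct rk k
  rank_rules : ∀ A α, (A, α) ∈ rules → α.rank rk = rk A

/-- Labelled binary trees: the syntactic tree of a term whose nodes additionally carry
nonterminals. A leaf `leaf A x` is one node, with nonterminal `A` and basic subterm `x`. -/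
inductive LabTree (N : Type v) (T : Type u) : Type (max u v)
  | leaf (A : N) (x : Term N T) : LabTree N T
  | concat (A : N) (s t : LabTree N T) : LabTree N T
  | wrap (A : N) (j : ℕ) (s t : LabTree N T) : LabTree N T

namespace LabTree

variable {N : Type v} {T : Type u}

/-- The nonterminal at the root. -/
def label : LabTree N T → N
  | leaf A _ => A
  | concat A _ _ => A
  | wrap A _ _ _ => A

/-- The term whose syntactic tree is decorated. -/
def term : LabTree N T → Term N T
  | leaf _ x => x
  | concat _ s t => .concat s.term t.term
  | wrap _ j s t => .wrap j s.term t.term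

/-- The subtree at an address, read from the root: `false` leads to the left child and `true` to
the right child. -/
def subtree : LabTree N T → List Bool → Option (LabTree N T)
  | t, [] => some t
  | leaf _ _, _ :: _ => none
  | concat _ s t, b :: p => if b then t.subtree p else s.subtree p
  | wrap _ _ s t, b :: p => if b then t.subtree p else s.subtree p

/-- The nodes of a tree, represented by their addresses. -/
def Node (t : LabTree N T) : Type := {p : List Bool // (t.subtree p).isSome}

/-- The nonterminal at a node. -/
def Node.label {t : LabTree N T} (x : t.Node) : N := ((t.subtree x.1).get x.2).label

/-- `y` is a child of `x`. -/
def Node.IsChild {t : LabTree N T} (x y : t.Node) : Prop := ∃ b : Bool, y.1 = x.1 ++ [b]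

/-- The (undirected) graph of the tree: edges join a node and its children. -/
def graph (t : LabTree N T) : SimpleGraph t.Node where
  Adj x y := x.IsChild y ∨ y.IsChild x
  symm := ⟨fun _ _ h => h.symm⟩
  loopless := ⟨by
    rintro x (⟨b, hb⟩ | ⟨b, hb⟩) <;> simpa using congrArg List.length hb⟩

end LabTree

namespace DCFG

variable {T : Type u} {k : ℕ}

/-- One rewriting step `C[B] ⇒ C[β]` with a rule `B → β`. -/
def Step (G : DCFG.{u, v} T k) (α α' : Term G.NT T) : Prop :=
  ∃ (C : Context G.NT T) (B : G.NT) (β : Term G.NT T),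
    (B, β) ∈ G.rules ∧ α = C.fill (.nt B) ∧ α' = C.fill β

/-- `A ⊢ α`: the term `α` is derivable from the nonterminal `A`. -/
def Derives (G : DCFG.{u, v} T k) (A : G.NT) (α : Term G.NT T) : Prop :=
  Relation.ReflTransGen G.Step (.nt A) α

/-- The set of words derivable from a nonterminal. (A derivable term is `k`-correct because all
right-hand sides are.) -/
def languageOf (G : DCFG.{u, v} T k) (A : G.NT) : Set (SepWord T) :=
  {w | ∃ α, G.Derives A α ∧ α.Ground ∧ α.value = w}

/-- The language generated by the grammar. -/
def language (G : DCFG.{u, v} T k) : Set (SepWord T) := G.languageOf G.start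

/-- Chomsky normal form: every rule has the form `A → B · C` or `A → B ⊙_j C` with `B` and `C`
distinct from the start symbol `S`, or `A → a` with `a` a letter or the separator, or `S → ε`. -/
def IsChomsky (G : DCFG.{u, v} T k) : Prop :=
  ∀ A α, (A, α) ∈ G.rules →
    (∃ B C, B ≠ G.start ∧ C ≠ G.start ∧ α = .concat (.nt B) (.nt C)) ∨
    (∃ j B C, B ≠ G.start ∧ C ≠ G.start ∧ α = .wrap j (.nt B) (.nt C)) ∨
    (∃ a, α = .word [a]) ∨
    α = .sep ∨
    (A = G.start ∧ α = .word [])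

/-- The derivation trees of ground terms in a grammar in Chomsky normal form: every internal node
with its children is an instance of a binary rule, and every leaf is an instance of a terminal
rule. -/
def IsDerivationTree (G : DCFG.{u, v} T k) : LabTree G.NT T → Prop
  | .leaf A x => (A, x) ∈ G.rules ∧ ((∃ w, x = .word w) ∨ x = .sep)
  | .concat A s t => (A, Term.concat (.nt s.label) (.nt t.label)) ∈ G.rules ∧
      G.IsDerivationTree s ∧ G.IsDerivationTree t
  | .wrap A j s t => (A, Term.wrap j (.nt s.label) (.nt t.label)) ∈ G.rules ∧
      G.IsDerivationTree s ∧ G.IsDerivationTree t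

/-- `t` is a derivation tree of the word `w` from the start symbol. -/
def IsDerivationTreeOf (G : DCFG.{u, v} T k) (t : LabTree G.NT T) (w : SepWord T) : Prop :=
  G.IsDerivationTree t ∧ t.label = G.start ∧ t.term.value = w

/-- The number `N_l` of nonterminals of rank `l`. -/
noncomputable def numNT (G : DCFG.{u, v} T k) (l : ℕ) : ℕ := Nat.card {A : G.NT // G.rk A = l}

/-- The rank of a node of a tree is the rank of its label. -/
def nodeRank (G : DCFG.{u, v} T k) {t : LabTree G.NT T} (x : t.Node) : ℕ := G.rk x.label

/-- An `l`-matryoshka: a contiguous part of a branch, listed from top to bottom, that consists of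
at least `N_l + 1` nodes, all of rank `l`. -/
def IsMatryoshka (G : DCFG.{u, v} T k) (t : LabTree G.NT T) (l : ℕ) (c : List t.Node) : Prop :=
  c.IsChain LabTree.Node.IsChild ∧ (∀ x ∈ c, G.nodeRank x = l) ∧ G.numNT l + 1 ≤ c.length

/-- A path in the tree is `l`-heavy if all its nodes (ends included) have rank at least `l`. -/
def IsHeavy (G : DCFG.{u, v} T k) {t : LabTree G.NT T} (l : ℕ) {x y : t.Node}
    (p : t.graph.Path x y) : Prop :=
  ∀ z ∈ p.1.support, l ≤ G.nodeRank z

/-- A grammar (in Chomsky normal form) is `m`-compact if every word of its language has a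
derivation tree in which every node of positive rank `l` is connected with an element of an
`l'`-matryoshka, for some `l' ≥ l`, by an `l`-heavy path of length at most `m`. -/
def IsCompact (G : DCFG.{u, v} T k) (m : ℕ) : Prop :=
  G.IsChomsky ∧ ∀ w ∈ G.language, ∃ t : LabTree G.NT T, G.IsDerivationTreeOf t w ∧
    ∀ x : t.Node, 0 < G.nodeRank x →
      ∃ l' : ℕ, G.nodeRank x ≤ l' ∧ ∃ c : List t.Node, G.IsMatryoshka t l' c ∧
        ∃ y ∈ c, ∃ p : t.graph.Path x y, G.IsHeavy (G.nodeRank x) p ∧ p.1.length ≤ m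

end DCFG

end Displacement

/-! The nonterminals of the new grammar are languages whose words have a fixed number of separators,
and its rules are all rules that are sound for these languages (`DCFG.ofLanguages`). Such a grammar
generates nothing superfluous (`Yields.mem_denote`), so it remains to find, for each word of L(G), a
good derivation tree with labels from one finite family (`Sound`).

Initial trees come from the subterms of right-hand sides. The empty word is eliminated by allowing
separators to be erased: intercalating an empty word just deletes a separator, so one takes the
languages of subterms with a chosen set of separators deleted (`Yields.exists_sound`).

Consider the connected sets of nodes of equal rank r > 0. Such a component is shallow if its root
has a parent of smaller rank and, below the root, there is neither a chain of N_r + 1 nodes of rank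
r (root included) nor a node of larger rank reached through at most N_r steps within the component.
Without shallow components the tree is compact: from any node of rank r > 0 one climbs at most N_r
steps and, if necessary, descends at most N_r steps, meeting a matryoshka or a node of larger rank.
The rank can grow only finitely often (`exists_heavilyJoined_matryoshka`).

Shallow components can be removed. If the root u has rank l and its parent a smaller rank, the
parent is u ⊙_j v with v of rank 0. Pushing v into the component lets all its operations be
rearranged so that only ranks below l occur (`exists_fill_shallow`). As the depth of the component
is bounded, only finitely many new languages are needed, all of rank less than l
(`exists_noShallow`). Hence N_r is unchanged for r ≥ l, and the ranks can be treated in decreasing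
order from k to 1 (`GeneratedWithoutShallow.succ`). -/

namespace Displacement

/-! ### Words with separators: filling and erasing -/

section Words

variable {T : Type u}

/-- The number of separators of a word. -/
def seps (x : SepWord T) : ℕ := x.countP Option.isNone

@[simp] lemma seps_nil : seps ([] : SepWord T) = 0 := rfl

@[simp] lemma seps_some_cons (a : T) (x : SepWord T) : seps (some a :: x) = seps x := by
  simp [seps]

@[simp] lemma seps_none_cons (x : SepWord T) : seps (none :: x) = seps x + 1 := by
  simp [seps]

@[simp] lemma seps_append (x y : SepWord T) : seps (x ++ y) = seps x + seps y := by
  simp [seps]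

@[simp] lemma seps_map_some (w : List T) : seps (w.map some) = 0 := by
  induction w <;> simp_all

/-- Simultaneous replacement of the separators of a word by the words of a list. -/
def fillSeps : SepWord T → List (SepWord T) → SepWord T
  | [], _ => []
  | some a :: x, ys => some a :: fillSeps x ys
  | none :: x, [] => none :: fillSeps x []
  | none :: x, y :: ys => y ++ fillSeps x ys

@[simp] lemma fillSeps_nil (ys : List (SepWord T)) : fillSeps [] ys = [] := by
  simp [fillSeps]

lemma fillSeps_append {x : SepWord T} {ys : List (SepWord T)} (h : ys.length = seps x)
    (x' : SepWord T) (ys' : List (SepWord T)) :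
    fillSeps (x ++ x') (ys ++ ys') = fillSeps x ys ++ fillSeps x' ys' := by
  induction x generalizing ys with
  | nil => obtain rfl : ys = [] := by simpa using h
           simp
  | cons a x ih =>
    cases a with
    | some a => simp only [seps_some_cons] at h; simp [fillSeps, ih h]
    | none =>
      cases ys with
      | nil => simp at h
      | cons y ys =>
        simp only [seps_none_cons, List.length_cons, add_left_inj] at h
        simp [fillSeps, ih h]

lemma fillSeps_split {x : SepWord T} {ys : List (SepWord T)} (h : ys.length = seps x)
    (y x' : SepWord T) (ys' : List (SepWord T)) :
    fillSeps (x ++ none :: x') (ys ++ y :: ys') = fillSeps x ys ++ (y ++ fillSeps x' ys') := by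
  rw [fillSeps_append h, fillSeps]

lemma seps_fillSeps {x : SepWord T} {ys : List (SepWord T)} (h : ys.length = seps x) :
    seps (fillSeps x ys) = (ys.map seps).sum := by
  induction x generalizing ys with
  | nil => obtain rfl : ys = [] := by simpa using h
           simp
  | cons a x ih =>
    cases a with
    | some a => simp only [seps_some_cons] at h; simp [fillSeps, ih h]
    | none =>
      cases ys with
      | nil => simp at h
      | cons y ys =>
        simp only [seps_none_cons, List.length_cons, add_left_inj] at h
        simp [fillSeps, ih h]

lemma fillSeps_replicate {x : SepWord T} {n : ℕ} (h : n = seps x) :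
    fillSeps x (List.replicate n [none]) = x := by
  subst h
  induction x with
  | nil => simp
  | cons a x ih => cases a <;> simp [fillSeps, List.replicate_succ, ih]

lemma exists_split {x : SepWord T} {j : ℕ} (h1 : 1 ≤ j) (hj : j ≤ seps x) :
    ∃ u v, x = u ++ none :: v ∧ seps u + 1 = j := by
  induction x generalizing j with
  | nil => simp at hj; omega
  | cons a x ih =>
    cases a with
    | some a =>
      obtain ⟨u, v, rfl, hu⟩ := ih h1 (by simpa using hj)
      exact ⟨some a :: u, v, rfl, by simpa using hu⟩
    | none =>
      rcases Nat.lt_or_ge 1 j with h | h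
      · simp only [seps_none_cons] at hj
        obtain ⟨u, v, rfl, hu⟩ := ih (j := j - 1) (by omega) (by omega)
        exact ⟨none :: u, v, rfl, by simp; omega⟩
      · exact ⟨[], x, rfl, by simp; omega⟩

lemma intercalate_split {u : SepWord T} {j : ℕ} (h : seps u + 1 = j) (v y : SepWord T) :
    intercalate j (u ++ none :: v) y = u ++ (y ++ v) := by
  induction u generalizing j with
  | nil => simp at h; simp [intercalate, ← h]
  | cons a u ih =>
    cases a with
    | some a => simp only [seps_some_cons] at h; simp [intercalate, ih h]
    | none =>
      simp only [seps_none_cons] at h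
      have : j ≠ 1 := by omega
      simp [intercalate, this, ih (j := j - 1) (by omega)]

lemma seps_intercalate {j : ℕ} {x : SepWord T} (h1 : 1 ≤ j) (hj : j ≤ seps x) (y : SepWord T) :
    seps (intercalate j x y) + 1 = seps x + seps y := by
  obtain ⟨u, v, rfl, hu⟩ := exists_split h1 hj
  rw [intercalate_split hu]
  simp; omega

/-- Associativity of substitution: a filling of x ⊙_j y is pushed into the operands, the filled y
becoming the j-th filler of x. -/
lemma fillSeps_intercalate {j : ℕ} {x : SepWord T} {y : SepWord T} {zs zs' zs'' : List (SepWord T)}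
    (hx : zs.length + 1 + zs''.length = seps x)
    (hz : zs.length + 1 = j) (hy : zs'.length = seps y) :
    fillSeps (intercalate j x y) (zs ++ (zs' ++ zs'')) = fillSeps x (zs ++ fillSeps y zs' :: zs'') := by
  obtain ⟨u, v, rfl, hu⟩ := exists_split (x := x) (j := j) (by omega) (by omega)
  rw [intercalate_split hu, fillSeps_split (by omega), fillSeps_append (by omega),
    fillSeps_append hy]

/-- A filler may be postponed: its place is first kept as a separator and then filled. The index
counts the separators contributed by the fillers to its left. -/
lemma intercalate_fillSeps {j : ℕ} {x : SepWord T} (y : SepWord T) {zs zs' : List (SepWord T)}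
    (hx : zs.length + 1 + zs'.length = seps x) (hj : (zs.map seps).sum + 1 = j) :
    intercalate j (fillSeps x (zs ++ [none] :: zs')) y = fillSeps x (zs ++ y :: zs') := by
  obtain ⟨u, v, rfl, hu⟩ := exists_split (x := x) (j := zs.length + 1) (by omega) (by omega)
  rw [fillSeps_split (by omega), fillSeps_split (by omega), List.singleton_append,
    intercalate_split (by rw [seps_fillSeps (by omega)]; exact hj)]

lemma fillSeps_keep_others {j n : ℕ} {x : SepWord T} (y : SepWord T)
    (hx : j + 1 + n = seps x) :
    fillSeps x (List.replicate j [none] ++ y :: List.replicate n [none]) =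
      intercalate (j + 1) x y := by
  obtain ⟨u, v, rfl, hu⟩ := exists_split (x := x) (j := j + 1) (by omega) (by omega)
  simp only [seps_append, seps_none_cons] at hx
  rw [fillSeps_split (by simp; omega), intercalate_split hu, fillSeps_replicate (by omega),
    fillSeps_replicate (by omega)]

/-- Deletion of the separators of a word that are marked by `false`. -/
def eraseSeps : List Bool → SepWord T → SepWord T
  | _, [] => []
  | b, some a :: x => some a :: eraseSeps b x
  | [], none :: x => none :: eraseSeps [] x
  | true :: b, none :: x => none :: eraseSeps b x
  | false :: b, none :: x => eraseSeps b x

@[simp] lemma eraseSeps_nil (b : List Bool) : eraseSeps b ([] : SepWord T) = [] := by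
  cases b <;> simp [eraseSeps]

@[simp] lemma eraseSeps_some_cons (b : List Bool) (a : T) (x : SepWord T) :
    eraseSeps b (some a :: x) = some a :: eraseSeps b x := by
  cases b <;> simp [eraseSeps]

lemma eraseSeps_append {b : List Bool} {x : SepWord T} (h : b.length = seps x) (b' : List Bool)
    (x' : SepWord T) : eraseSeps (b ++ b') (x ++ x') = eraseSeps b x ++ eraseSeps b' x' := by
  induction x generalizing b with
  | nil => obtain rfl : b = [] := by simpa using h
           simp
  | cons a x ih =>
    cases a with
    | some a => simp only [seps_some_cons] at h; simp [ih h]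
    | none =>
      rcases b with _ | ⟨_ | _, b⟩
      · simp at h
      all_goals
        simp only [seps_none_cons, List.length_cons, add_left_inj] at h
        simp [eraseSeps, ih h]

lemma seps_eraseSeps {b : List Bool} {x : SepWord T} (h : b.length = seps x) :
    seps (eraseSeps b x) = b.count true := by
  induction x generalizing b with
  | nil => obtain rfl : b = [] := by simpa using h
           simp
  | cons a x ih =>
    cases a with
    | some a => simp only [seps_some_cons] at h; simp [ih h]
    | none =>
      rcases b with _ | ⟨_ | _, b⟩
      · simp at h
      all_goals
        simp only [seps_none_cons, List.length_cons, add_left_inj] at h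
        simp [eraseSeps, ih h]

lemma eraseSeps_of_seps_eq_zero {b : List Bool} {x : SepWord T} (h : seps x = 0) :
    eraseSeps b x = x := by
  induction x generalizing b with
  | nil => simp
  | cons a x ih =>
    cases a with
    | some a => simp_all
    | none => simp at h

lemma eraseSeps_intercalate_keep {b b' b'' : List Bool} {j : ℕ} {x y : SepWord T}
    (hb : b.length + 1 = j) (hx : b.length + 1 + b''.length = seps x) (hy : b'.length = seps y) :
    eraseSeps (b ++ (b' ++ b'')) (intercalate j x y) =
      intercalate (b.count true + 1) (eraseSeps (b ++ true :: b'') x) (eraseSeps b' y) := by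
  obtain ⟨u, v, rfl, hu⟩ := exists_split (x := x) (j := j) (by omega) (by omega)
  rw [intercalate_split hu, eraseSeps_append (by omega), eraseSeps_append hy,
    eraseSeps_append (by omega), eraseSeps, intercalate_split (by rw [seps_eraseSeps (by omega)])]

/-- This identity removes empty operands: an intercalated word that is erased completely amounts to
marking one more separator of `x` for deletion. -/
lemma eraseSeps_intercalate_erase {b b' b'' : List Bool} {j : ℕ} {x y : SepWord T}
    (hb : b.length + 1 = j) (hx : b.length + 1 + b''.length = seps x) (hy : b'.length = seps y)
    (h : eraseSeps b' y = []) :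
    eraseSeps (b ++ (b' ++ b'')) (intercalate j x y) = eraseSeps (b ++ false :: b'') x := by
  obtain ⟨u, v, rfl, hu⟩ := exists_split (x := x) (j := j) (by omega) (by omega)
  rw [intercalate_split hu, eraseSeps_append (by omega), eraseSeps_append hy,
    eraseSeps_append (by omega), eraseSeps, h, List.nil_append]

end Words

end Displacement

/-! ### Labelled trees and shallow components -/

namespace Displacement

namespace LabTree

variable {N : Type v} {T : Type u}

/-- The immediate subtrees. -/
def children : LabTree N T → List (LabTree N T)
  | leaf _ _ => []
  | concat _ s t => [s, t]
  | wrap _ _ s t => [s, t]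

/-- Below the root there is a chain of `n + 1` nodes of rank `r` that starts at the root, or such
a chain of at most `n` nodes followed by a node of rank greater than `r`. -/
def Reaches (rk : N → ℕ) (r : ℕ) : ℕ → LabTree N T → Prop
  | 0, _ => True
  | n + 1, t => ∃ s ∈ t.children, r < rk s.label ∨ rk s.label = r ∧ Reaches rk r n s

/-- Every subtree with a root of rank `r ≥ l` whose parent has a smaller rank satisfies
`Reaches rk r (n r)`; here `q` is the rank of the parent of the root. -/
def NoShallow (rk : N → ℕ) (n : ℕ → ℕ) (l : ℕ) : ℕ → LabTree N T → Prop
  | q, leaf A x => l ≤ rk A → q < rk A → (leaf A x).Reaches rk (rk A) (n (rk A))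
  | q, concat A s t => (l ≤ rk A → q < rk A → (concat A s t).Reaches rk (rk A) (n (rk A))) ∧
      NoShallow rk n l (rk A) s ∧ NoShallow rk n l (rk A) t
  | q, wrap A j s t => (l ≤ rk A → q < rk A → (wrap A j s t).Reaches rk (rk A) (n (rk A))) ∧
      NoShallow rk n l (rk A) s ∧ NoShallow rk n l (rk A) t

/-- Replacement of the nonterminal at the root. -/
def relabel (B : N) : LabTree N T → LabTree N T
  | leaf _ x => leaf B x
  | concat _ s t => concat B s t
  | wrap _ j s t => wrap B j s t

@[simp] lemma label_leaf (A : N) (x : Term N T) : (leaf A x).label = A := rfl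

@[simp] lemma label_concat (A : N) (s t : LabTree N T) : (concat A s t).label = A := rfl

@[simp] lemma label_wrap (A : N) (j : ℕ) (s t : LabTree N T) : (wrap A j s t).label = A := rfl

@[simp] lemma label_relabel (B : N) (t : LabTree N T) : (t.relabel B).label = B := by
  cases t <;> rfl

@[simp] lemma term_relabel (B : N) (t : LabTree N T) : (t.relabel B).term = t.term := by
  cases t <;> rfl

@[simp] lemma children_relabel (B : N) (t : LabTree N T) :
    (t.relabel B).children = t.children := by
  cases t <;> rfl

lemma reaches_relabel {rk : N → ℕ} {r n : ℕ} {B : N} {t : LabTree N T} :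
    (t.relabel B).Reaches rk r n ↔ t.Reaches rk r n := by
  cases n <;> simp [Reaches]

lemma noShallow_iff {rk : N → ℕ} {n : ℕ → ℕ} {l q : ℕ} {t : LabTree N T} :
    t.NoShallow rk n l q ↔
      (l ≤ rk t.label → q < rk t.label → t.Reaches rk (rk t.label) (n (rk t.label))) ∧
      ∀ s ∈ t.children, s.NoShallow rk n l (rk t.label) := by
  cases t <;> simp [NoShallow, label, children]

lemma NoShallow.relabel {rk : N → ℕ} {n : ℕ → ℕ} {l q : ℕ} {t : LabTree N T}
    (h : t.NoShallow rk n l q) {B : N} (hB : rk B = rk t.label) :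
    (t.relabel B).NoShallow rk n l q := by
  rw [noShallow_iff] at h ⊢
  simpa [hB, reaches_relabel] using h

/-- The rank of the parent matters only for roots of rank at least `l`, so a tree with a smaller
root can be moved under any other parent. -/
lemma NoShallow.of_rank_lt {rk : N → ℕ} {n : ℕ → ℕ} {l q : ℕ} {t : LabTree N T}
    (h : t.NoShallow rk n l q) (ht : rk t.label < l) (q' : ℕ) : t.NoShallow rk n l q' := by
  rw [noShallow_iff] at h ⊢
  exact ⟨fun h' => absurd h' (by omega), h.2⟩

lemma NoShallow.congr {rk : N → ℕ} {n n' : ℕ → ℕ} {l q : ℕ} {t : LabTree N T}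
    (hn : ∀ r, l ≤ r → n r = n' r) (h : t.NoShallow rk n l q) : t.NoShallow rk n' l q := by
  induction t generalizing q with
  | leaf A x => exact fun h1 h2 => hn _ h1 ▸ h h1 h2
  | concat A s t ihs iht => exact ⟨fun h1 h2 => hn _ h1 ▸ h.1 h1 h2, ihs h.2.1, iht h.2.2⟩
  | wrap A j s t ihs iht => exact ⟨fun h1 h2 => hn _ h1 ▸ h.1 h1 h2, ihs h.2.1, iht h.2.2⟩

end LabTree

/-! ### Languages as labels and sound trees -/

/-- A language over the extended alphabet whose words have a fixed number of separators. -/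
structure RankedLanguage (T : Type u) where
  /-- the number of separators -/
  rk : ℕ
  /-- the set of words -/
  lang : Set (SepWord T)
  seps_eq : ∀ w ∈ lang, seps w = rk

namespace RankedLanguage

variable {T : Type u}

/-- The language of the separator. -/
def sep : RankedLanguage T := ⟨1, {[none]}, by rintro _ rfl; rfl⟩

@[simp] lemma rk_sep : (sep : RankedLanguage T).rk = 1 := rfl

/-- Concatenation of languages. -/
def concat (L M : RankedLanguage T) : RankedLanguage T :=
  ⟨L.rk + M.rk, Set.image2 (· ++ ·) L.lang M.lang, by
    rintro _ ⟨x, hx, y, hy, rfl⟩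
    simp [L.seps_eq x hx, M.seps_eq y hy]⟩

/-- Intercalation of languages. -/
def wrap (j : ℕ) (L M : RankedLanguage T) : RankedLanguage T :=
  ⟨L.rk + M.rk - 1, {w ∈ Set.image2 (intercalate j) L.lang M.lang | seps w = L.rk + M.rk - 1},
    fun _ h => h.2⟩

end RankedLanguage

namespace LabTree

variable {T : Type u}

/-- The word at the root. -/
def value {N : Type v} (t : LabTree N T) : SepWord T := t.term.value

@[simp] lemma value_relabel {N : Type v} (B : N) (t : LabTree N T) :
    (t.relabel B).value = t.value := by
  simp [value]

@[simp] lemma value_concat {N : Type v} (A : N) (s t : LabTree N T) :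
    (concat A s t).value = s.value ++ t.value := rfl

@[simp] lemma value_wrap {N : Type v} (A : N) (j : ℕ) (s t : LabTree N T) :
    (wrap A j s t).value = intercalate j s.value t.value := rfl

/-- The trees labelled with languages from `F` such that the label of each node contains the
result of the operation at that node applied to the labels of its children. -/
def Sound (F : Set (RankedLanguage T)) : LabTree (RankedLanguage T) T → Prop
  | leaf A x => A ∈ F ∧ ((∃ a, x = .word [a]) ∨ x = .sep) ∧ x.value ∈ A.lang
  | concat A s t => A ∈ F ∧ A.rk = s.label.rk + t.label.rk ∧
      (∀ x ∈ s.label.lang, ∀ y ∈ t.label.lang, x ++ y ∈ A.lang) ∧ s.Sound F ∧ t.Sound F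
  | wrap A j s t => A ∈ F ∧ A.rk + 1 = s.label.rk + t.label.rk ∧ (1 ≤ j ∧ j ≤ s.label.rk) ∧
      (∀ x ∈ s.label.lang, ∀ y ∈ t.label.lang, intercalate j x y ∈ A.lang) ∧
      s.Sound F ∧ t.Sound F

variable {F F' : Set (RankedLanguage T)} {t : LabTree (RankedLanguage T) T}

lemma Sound.label_mem (h : t.Sound F) : t.label ∈ F := by
  cases t <;> exact h.1

lemma Sound.value_mem (h : t.Sound F) : t.value ∈ t.label.lang := by
  induction t with
  | leaf A x => exact h.2.2
  | concat A s t ihs iht => exact h.2.2.1 _ (ihs h.2.2.2.1) _ (iht h.2.2.2.2)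
  | wrap A j s t ihs iht => exact h.2.2.2.1 _ (ihs h.2.2.2.2.1) _ (iht h.2.2.2.2.2)

lemma Sound.seps_value (h : t.Sound F) : seps t.value = t.label.rk :=
  t.label.seps_eq _ h.value_mem

lemma Sound.mono (hF : F ⊆ F') (h : t.Sound F) : t.Sound F' := by
  induction t with
  | leaf A x => exact ⟨hF h.1, h.2⟩
  | concat A s t ihs iht =>
    exact ⟨hF h.1, h.2.1, h.2.2.1, ihs h.2.2.2.1, iht h.2.2.2.2⟩
  | wrap A j s t ihs iht =>
    exact ⟨hF h.1, h.2.1, h.2.2.1, h.2.2.2.1, ihs h.2.2.2.2.1, iht h.2.2.2.2.2⟩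

/-- Enlarging the language at the root preserves soundness, because the root is nobody's operand.
This absorbs unit rules. -/
lemma Sound.relabel (h : t.Sound F) {A : RankedLanguage T} (hA : A ∈ F)
    (hr : A.rk = t.label.rk) (hl : t.label.lang ⊆ A.lang) : (t.relabel A).Sound F := by
  cases t with
  | leaf B x => exact ⟨hA, h.2.1, hl h.2.2⟩
  | concat B s t =>
    exact ⟨hA, hr.trans h.2.1, fun x hx y hy => hl (h.2.2.1 x hx y hy), h.2.2.2⟩
  | wrap B j s t =>
    refine ⟨hA, ?_, h.2.2.1, fun x hx y hy => hl (h.2.2.2.1 x hx y hy), h.2.2.2.2⟩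
    rw [hr]; exact h.2.1

end LabTree

end Displacement

namespace Displacement

open LabTree RankedLanguage

lemma exists_append_of_length {α : Type*} {l : List α} {m n : ℕ} (h : l.length = m + n) :
    ∃ l₁ l₂, l = l₁ ++ l₂ ∧ l₁.length = m ∧ l₂.length = n :=
  ⟨l.take m, l.drop m, (List.take_append_drop m l).symm, by simp; omega, by simp; omega⟩

lemma forall₂_append_right {α β : Type*} {R : α → β → Prop} {l : List α} {m m' : List β}
    (h : List.Forall₂ R l (m ++ m')) :
    ∃ l₁ l₂, l = l₁ ++ l₂ ∧ List.Forall₂ R l₁ m ∧ List.Forall₂ R l₂ m' := by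
  induction m generalizing l with
  | nil => exact ⟨[], l, rfl, .nil, h⟩
  | cons b m ih =>
    obtain ⟨a, l', hab, hl, rfl⟩ := List.forall₂_cons_right_iff.1 h
    obtain ⟨l₁, l₂, rfl, h₁, h₂⟩ := ih hl
    exact ⟨a :: l₁, l₂, rfl, .cons hab h₁, h₂⟩

lemma forall₂_append {α β : Type*} {R : α → β → Prop} {l l' : List α} {m m' : List β}
    (h : List.Forall₂ R l m) (h' : List.Forall₂ R l' m') : List.Forall₂ R (l ++ l') (m ++ m') := by
  induction h with
  | nil => exact h'
  | cons hab _ ih => exact .cons hab ih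

/-! ### Rearranging a shallow component in ranks below `l` -/

section Flattening

variable {T : Type u}

/-- The languages of rank less than `l` obtained from those of `F` and from the separator by
at most `s` nested operations all of whose results have rank less than `l`. -/
def smallClosure (F : Set (RankedLanguage T)) (l : ℕ) : ℕ → Set (RankedLanguage T)
  | 0 => {A ∈ insert RankedLanguage.sep F | A.rk < l}
  | s + 1 => smallClosure F l s ∪
      {A | A.rk < l ∧ A ∈ Set.image2 RankedLanguage.concat (smallClosure F l s) (smallClosure F l s)} ∪
      {A | A.rk < l ∧ A ∈ ⋃ j ∈ Set.Iic l,
        Set.image2 (RankedLanguage.wrap j) (smallClosure F l s) (smallClosure F l s)}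

variable {F F' : Set (RankedLanguage T)} {l : ℕ}

lemma finite_smallClosure (hF : F.Finite) (s : ℕ) : (smallClosure F l s).Finite := by
  induction s with
  | zero => exact (hF.insert _).subset fun _ h => h.1
  | succ s ih =>
    refine (ih.union ((ih.image2 _ ih).subset fun _ h => h.2)).union
      (Set.Finite.subset ?_ fun _ h => h.2)
    exact (Set.finite_Iic l).biUnion fun j _ => ih.image2 _ ih

lemma rk_lt_of_mem_smallClosure {s : ℕ} {A : RankedLanguage T} (h : A ∈ smallClosure F l s) :
    A.rk < l := by
  induction s with
  | zero => exact h.2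
  | succ s ih =>
    rcases h with (h | h) | h
    exacts [ih h, h.1, h.1]

lemma smallClosure_mono : Monotone (smallClosure F l) :=
  monotone_nat_of_le_succ fun _ _ h => Or.inl (Or.inl h)

/-- Sound trees whose root label belongs to `G` and in which no component of rank at least `l`
is shallow. -/
structure SmallTree (F' : Set (RankedLanguage T)) (n : ℕ → ℕ) (l : ℕ)
    (G : Set (RankedLanguage T)) (t : LabTree (RankedLanguage T) T) : Prop where
  label_mem : t.label ∈ G
  sound : t.Sound F'
  noShallow : t.NoShallow RankedLanguage.rk n l 0

variable {n : ℕ → ℕ} {s s' : ℕ} {t t' : LabTree (RankedLanguage T) T}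

lemma SmallTree.mono (h : SmallTree F' n l (smallClosure F l s) t) (hs : s ≤ s') :
    SmallTree F' n l (smallClosure F l s') t :=
  ⟨smallClosure_mono hs h.1, h.2, h.3⟩

lemma SmallTree.rk_lt (h : SmallTree F' n l (smallClosure F l s) t) : t.label.rk < l :=
  rk_lt_of_mem_smallClosure h.1

lemma SmallTree.concat (h : SmallTree F' n l (smallClosure F l s) t)
    (h' : SmallTree F' n l (smallClosure F l s) t') (hl : t.label.rk + t'.label.rk < l)
    (hF' : smallClosure F l (s + 1) ⊆ F') :
    SmallTree F' n l (smallClosure F l (s + 1)) (.concat (t.label.concat t'.label) t t') := by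
  have hm : t.label.concat t'.label ∈ smallClosure F l (s + 1) :=
    Or.inl (Or.inr ⟨hl, Set.mem_image2_of_mem h.1 h'.1⟩)
  refine ⟨hm, ⟨hF' hm, rfl, fun x hx y hy => Set.mem_image2_of_mem hx hy, h.2, h'.2⟩, ?_, ?_, ?_⟩
  · intro h1; exact absurd hl (Nat.not_lt.2 h1)
  · exact h.3.of_rank_lt h.rk_lt _
  · exact h'.3.of_rank_lt h'.rk_lt _

/-- The bound is `≤ l` because intercalation consumes one separator. Both operands have rank below
`l`, so neither becomes the root of a component of rank at least `l`. -/
lemma SmallTree.wrap (h : SmallTree F' n l (smallClosure F l s) t)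
    (h' : SmallTree F' n l (smallClosure F l s) t') (hl : t.label.rk + t'.label.rk ≤ l)
    {j : ℕ} (hj1 : 1 ≤ j) (hj : j ≤ t.label.rk)
    (hF' : smallClosure F l (s + 1) ⊆ F') :
    SmallTree F' n l (smallClosure F l (s + 1)) (.wrap (t.label.wrap j t'.label) j t t') := by
  have ht := h.rk_lt
  have hr : (t.label.wrap j t'.label).rk = t.label.rk + t'.label.rk - 1 := rfl
  have hm : t.label.wrap j t'.label ∈ smallClosure F l (s + 1) := by
    refine Or.inr ⟨by omega, Set.mem_biUnion (x := j) (by simp; omega) ?_⟩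
    exact Set.mem_image2_of_mem h.1 h'.1
  refine ⟨hm, ⟨hF' hm, by omega, ⟨hj1, hj⟩, fun x hx y hy => ⟨Set.mem_image2_of_mem hx hy, ?_⟩,
    h.2, h'.2⟩, ?_, ?_, ?_⟩
  · have hx' := t.label.seps_eq x hx
    have := seps_intercalate hj1 (hx' ▸ hj) y
    have := t'.label.seps_eq y hy
    omega
  · intro h1; exact absurd h1 (by omega)
  · exact h.3.of_rank_lt h.rk_lt _
  · exact h'.3.of_rank_lt h'.rk_lt _

/-- The label of `t` contains only words obtained from words of `A` by replacing all separators
by words from the labels of the trees in `σ`, and `t` has the corresponding rank. -/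
def FillsLabel (A : RankedLanguage T) (σ : List (LabTree (RankedLanguage T) T))
    (t : LabTree (RankedLanguage T) T) : Prop :=
  t.label.rk = (σ.map fun τ => τ.label.rk).sum ∧
  ∀ w ∈ t.label.lang, ∃ x ∈ A.lang, ∃ ys,
    List.Forall₂ (fun y (τ : LabTree (RankedLanguage T) T) => y ∈ τ.label.lang) ys σ ∧
      w = fillSeps x ys

/-- Replacing separators one after another. -/
lemma exists_fill_small {s₀ : ℕ} (σ : List (LabTree (RankedLanguage T) T)) :
    ∀ (s : ℕ) (t : LabTree (RankedLanguage T) T) (p : ℕ), s₀ ≤ s →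
    SmallTree F' n l (smallClosure F l s) t → p + σ.length = t.label.rk →
    (∀ τ ∈ σ, SmallTree F' n l (smallClosure F l s₀) τ ∧ τ.label.rk ≤ 1) →
    smallClosure F l (s + σ.length) ⊆ F' →
    ∃ t', SmallTree F' n l (smallClosure F l (s + σ.length)) t' ∧
      t'.value = fillSeps t.value (List.replicate p [none] ++ σ.map LabTree.value) ∧
      t'.label.rk = p + (σ.map fun τ => τ.label.rk).sum ∧
      ∀ w ∈ t'.label.lang, ∃ x ∈ t.label.lang, ∃ ys,
        List.Forall₂ (fun y (τ : LabTree (RankedLanguage T) T) => y ∈ τ.label.lang) ys σ ∧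
        w = fillSeps x (List.replicate p [none] ++ ys) := by
  -- The first `p` separators are final. Filling the next one by `y` makes the separators of `y`
  -- final too, so `p` grows by `seps y`.
  have key : ∀ (p : ℕ) (x y : SepWord T) (zs : List (SepWord T)), p + 1 + zs.length = seps x →
      fillSeps (intercalate (p + 1) x y) (List.replicate (p + seps y) [none] ++ zs) =
        fillSeps x (List.replicate p [none] ++ y :: zs) := by
    intro p x y zs h
    rw [List.replicate_add, List.append_assoc,
      fillSeps_intercalate (by simpa using h) (by simp) (by simp), fillSeps_replicate rfl]
  induction σ with
  | nil =>
    intro s t p _ ht hp _ _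
    simp only [List.length_nil, add_zero] at hp
    refine ⟨t, ht, ?_, by simp [hp], fun w hw => ⟨w, hw, [], .nil, ?_⟩⟩
    · simp [fillSeps_replicate (hp.trans ht.sound.seps_value.symm)]
    · simp [fillSeps_replicate (hp.trans (t.label.seps_eq w hw).symm)]
  | cons τ σ ih =>
    intro s t p hs ht hp hσ hF'
    obtain ⟨⟨hτ, hτ1⟩, hσ⟩ := List.forall_mem_cons.1 hσ
    simp only [List.length_cons] at hp hF'
    have htl := ht.rk_lt
    -- A filler of rank at most 1 does not increase the rank, so all intermediate results stay below
    -- `l`.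
    have ht1 := ht.wrap (hτ.mono hs) (j := p + 1) (by omega) (by omega) (by omega)
      ((smallClosure_mono (by omega)).trans hF')
    have hlen : s + 1 + σ.length = s + (σ.length + 1) := by omega
    obtain ⟨t', h1, h2, h3, h4⟩ := ih (s + 1) _ (p + τ.label.rk) (by omega) ht1
      (by show _ = _ + _ - 1; omega) hσ (hlen ▸ hF')
    rw [hlen] at h1
    refine ⟨t', h1, ?_, ?_, fun w hw => ?_⟩
    · rw [h2, value_wrap, ← hτ.sound.seps_value,
        key _ _ _ _ (by rw [ht.sound.seps_value, List.length_map]; omega), List.map_cons]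
    · simp [h3, add_assoc]
    · obtain ⟨x', ⟨⟨x, hx, y, hy, rfl⟩, -⟩, ys, hys, rfl⟩ := h4 w hw
      refine ⟨x, hx, y :: ys, .cons hy hys, ?_⟩
      rw [← τ.label.seps_eq y hy, key]
      rw [t.label.seps_eq x hx, hys.length_eq]; omega

/-- Replacing all separators of the root of a shallow component by trees of rank at most `1`,
without using labels of rank `l` or more. -/
lemma exists_fill_shallow (F : Set (RankedLanguage T)) (l h : ℕ) : ∀ s, ∃ s', s ≤ s' ∧
    ∀ (F' : Set (RankedLanguage T)) (n : ℕ → ℕ), smallClosure F l s' ⊆ F' →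
    ∀ (c : LabTree (RankedLanguage T) T) (q : ℕ), c.Sound F →
    (c.label.rk < l ∨ c.label.rk = l ∧ ¬ c.Reaches RankedLanguage.rk l h) →
    c.NoShallow RankedLanguage.rk n (l + 1) q →
    (∀ (d : LabTree (RankedLanguage T) T) (q' : ℕ), sizeOf d ≤ sizeOf c → d.Sound F →
      d.label.rk < l → d.NoShallow RankedLanguage.rk n (l + 1) q' →
      ∃ d' : LabTree (RankedLanguage T) T, d'.label = d.label ∧ d'.value = d.value ∧
        d'.Sound F' ∧ d'.NoShallow RankedLanguage.rk n l 0) →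
    ∀ σ : List (LabTree (RankedLanguage T) T), σ.length = c.label.rk →
    (∀ τ ∈ σ, SmallTree F' n l (smallClosure F l s) τ ∧ τ.label.rk ≤ 1) →
    (σ.map fun τ => τ.label.rk).sum < l →
    ∃ t, SmallTree F' n l (smallClosure F l s') t ∧
      t.value = fillSeps c.value (σ.map LabTree.value) ∧ FillsLabel c.label σ t := by
  -- A tree of rank below `l` hangs off the component: it is replaced by its recursively transformed
  -- version and its fewer than `l` separators are filled one by one.
  have base : ∀ s s', s + l ≤ s' →
    ∀ (F' : Set (RankedLanguage T)) (n : ℕ → ℕ), smallClosure F l s' ⊆ F' →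
    ∀ (c : LabTree (RankedLanguage T) T) (q : ℕ), c.Sound F → c.label.rk < l →
    c.NoShallow RankedLanguage.rk n (l + 1) q →
    (∀ (d : LabTree (RankedLanguage T) T) (q' : ℕ), sizeOf d ≤ sizeOf c → d.Sound F →
      d.label.rk < l → d.NoShallow RankedLanguage.rk n (l + 1) q' →
      ∃ d' : LabTree (RankedLanguage T) T, d'.label = d.label ∧ d'.value = d.value ∧
        d'.Sound F' ∧ d'.NoShallow RankedLanguage.rk n l 0) →
    ∀ σ : List (LabTree (RankedLanguage T) T), σ.length = c.label.rk →
    (∀ τ ∈ σ, SmallTree F' n l (smallClosure F l s) τ ∧ τ.label.rk ≤ 1) →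
    ∃ t, SmallTree F' n l (smallClosure F l s') t ∧
      t.value = fillSeps c.value (σ.map LabTree.value) ∧ FillsLabel c.label σ t := by
    intro s s' hs F' n hF' c q hc hcl hcn hang σ hσl hσ
    obtain ⟨d, hd1, hd2, hd3, hd4⟩ := hang c q le_rfl hc hcl hcn
    have hd : SmallTree F' n l (smallClosure F l s) d :=
      ⟨smallClosure_mono (Nat.zero_le _) ⟨Or.inr (hd1 ▸ hc.label_mem), hd1 ▸ hcl⟩, hd3, hd4⟩
    obtain ⟨t, h1, h2, h3, h4⟩ := exists_fill_small σ s d 0 le_rfl hd (by rw [hd1]; omega) hσ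
      ((smallClosure_mono (by omega)).trans hF')
    refine ⟨t, h1.mono (by omega), by simpa [hd2] using h2, by simpa using h3, ?_⟩
    simpa [hd1] using h4
  induction h with
  | zero =>
    intro s
    refine ⟨s + l, by omega, fun F' n hF' c q hc hcl hcn hang σ hσl hσ _ => ?_⟩
    -- `Reaches` with bound 0 always holds, so a root of rank `l` is impossible here.
    exact base s _ le_rfl F' n hF' c q hc (hcl.resolve_right fun h => h.2 trivial) hcn hang σ hσl hσ
  | succ h ih =>
    intro s
    obtain ⟨s₁, hs₁, ih₁⟩ := ih s
    obtain ⟨s₂, hs₂, ih₂⟩ := ih s₁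
    -- `s₁` levels suffice for filling the right operand, `s₂` for filling the left one with that
    -- result among the fillers, and one more level for the operation itself; `l` levels are
    -- reserved for the case of small rank.
    refine ⟨s₂ + 1 + l, by omega, fun F' n hF' c q hc hcl hcn hang σ hσl hσ hσs => ?_⟩
    have hF₁ := (smallClosure_mono (F := F) (l := l) (show s₁ ≤ s₂ + 1 + l by omega)).trans hF'
    have hF₂ := (smallClosure_mono (F := F) (l := l) (show s₂ ≤ s₂ + 1 + l by omega)).trans hF'
    have hF₃ := (smallClosure_mono (F := F) (l := l) (show s₂ + 1 ≤ s₂ + 1 + l by omega)).trans hF'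
    rcases hcl with hcl | ⟨hcl, hcr⟩
    · exact base s _ (by omega) F' n hF' c q hc hcl hcn hang σ hσl hσ
    have hchild : ∀ d ∈ c.children,
        d.label.rk < l ∨ d.label.rk = l ∧ ¬ d.Reaches RankedLanguage.rk l h := by
      intro d hd
      by_contra hcon
      push Not at hcon
      refine hcr ⟨d, hd, ?_⟩
      rcases hcon.1.lt_or_eq with h' | h'
      exacts [Or.inl h', Or.inr ⟨h'.symm, hcon.2 h'.symm⟩]
    have hchildn := (noShallow_iff.1 hcn).2
    cases c with
    | leaf A x =>
      obtain ⟨hA, hx, hxA⟩ := hc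
      have hr := A.seps_eq _ hxA
      change A.rk = l at hcl
      change σ.length = A.rk at hσl
      rcases hx with ⟨a, rfl⟩ | rfl
      · simp [Term.value] at hr; omega
      · simp only [Term.value, seps_none_cons, seps_nil, zero_add] at hr
        -- Filling a lone separator returns the filler itself.
        obtain ⟨τ, rfl⟩ := List.length_eq_one_iff.1 (hσl.trans hr.symm)
        refine ⟨τ, (hσ τ (by simp)).1.mono (by omega), ?_, by simp, fun w hw => ?_⟩
        · simp [LabTree.value, term, Term.value, fillSeps]
        · exact ⟨_, hxA, [w], .cons hw .nil, by simp [Term.value, fillSeps]⟩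
    | concat A a b =>
      obtain ⟨hA, hr, hl, ha, hb⟩ := hc
      change σ.length = A.rk at hσl
      obtain ⟨σ₁, σ₂, rfl, hσ₁, hσ₂⟩ := exists_append_of_length (hσl.trans hr)
      simp only [List.map_append, List.sum_append] at hσs
      obtain ⟨t₁, h1, h1v, h1r, h1l⟩ := ih₁ F' n hF₁ a _ ha (hchild a (by simp [children]))
        (hchildn a (by simp [children]))
        (fun d q' hd => hang d q' (by simp; omega)) σ₁ hσ₁
        (fun τ hτ => hσ τ (by simp [hτ])) (by omega)
      obtain ⟨t₂, h2, h2v, h2r, h2l⟩ := ih₁ F' n hF₁ b _ hb (hchild b (by simp [children]))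
        (hchildn b (by simp [children]))
        (fun d q' hd => hang d q' (by simp; omega)) σ₂ hσ₂
        (fun τ hτ => hσ τ (by simp [hτ])) (by omega)
      refine ⟨_, ((h1.mono hs₂).concat (h2.mono hs₂) (by omega) hF₃).mono (by omega), ?_, ?_, ?_⟩
      · rw [value_concat, value_concat, List.map_append,
          fillSeps_append (by rw [ha.seps_value, List.length_map, hσ₁]), h1v, h2v]
      · simp [RankedLanguage.concat, h1r, h2r]
      · rintro _ ⟨u, hu, v, hv, rfl⟩
        obtain ⟨x, hx, ys, hys, rfl⟩ := h1l u hu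
        obtain ⟨x', hx', ys', hys', rfl⟩ := h2l v hv
        refine ⟨_, hl x hx x' hx', ys ++ ys', forall₂_append hys hys', ?_⟩
        rw [fillSeps_append (by rw [a.label.seps_eq x hx, hys.length_eq, hσ₁])]
    | wrap A j a b =>
      obtain ⟨hA, hr, ⟨hj1, hj⟩, hl, ha, hb⟩ := hc
      change σ.length = A.rk at hσl
      obtain ⟨σ₁, σ', rfl, hσ₁, hσ'⟩ := exists_append_of_length (l := σ) (m := j - 1)
        (n := b.label.rk + (a.label.rk - j)) (by omega)
      obtain ⟨σ₂, σ₃, rfl, hσ₂, hσ₃⟩ := exists_append_of_length hσ'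
      simp only [List.map_append, List.sum_append] at hσs
      obtain ⟨τ, h2, h2v, h2r, h2l⟩ := ih₁ F' n hF₁ b _ hb (hchild b (by simp [children]))
        (hchildn b (by simp [children]))
        (fun d q' hd => hang d q' (by simp; omega)) σ₂ hσ₂
        (fun τ hτ => hσ τ (by simp [hτ])) (by omega)
      have hfill : ∃ t, SmallTree F' n l (smallClosure F l (s₂ + 1)) t ∧
          t.value = fillSeps a.value ((σ₁ ++ τ :: σ₃).map LabTree.value) ∧
          FillsLabel a.label (σ₁ ++ τ :: σ₃) t := by
        have IH := ih₂ F' n hF₂ a _ ha (hchild a (by simp [children]))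
          (hchildn a (by simp [children])) (fun d q' hd => hang d q' (by simp; omega))
        by_cases hτ : τ.label.rk ≤ 1
        · obtain ⟨t, ht, h⟩ := IH (σ₁ ++ τ :: σ₃) (by simp; omega) (fun τ' hτ' => by
            simp only [List.mem_append, List.mem_cons] at hτ'
            rcases hτ' with h | rfl | h
            · exact (hσ τ' (by simp [h])).imp_left fun h => h.mono hs₁
            · exact ⟨h2, hτ⟩
            · exact (hσ τ' (by simp [h])).imp_left fun h => h.mono hs₁) (by simp; omega)
          exact ⟨t, ht.mono (by omega), h⟩
        -- The rank of `τ` is at least 2 and is bounded by the sum of the ranks in `σ`, whence `1 <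
        -- l`.
        · have hm : RankedLanguage.sep ∈ smallClosure F l s₁ := by
            refine smallClosure_mono (Nat.zero_le _) ⟨Set.mem_insert _ _, ?_⟩
            change 1 < l
            omega
          obtain ⟨t, ht, htv, htr, htl⟩ :=
              IH (σ₁ ++ .leaf RankedLanguage.sep .sep :: σ₃) (by simp; omega) (fun τ' hτ' => by
            simp only [List.mem_append, List.mem_cons] at hτ'
            rcases hτ' with h | rfl | h
            · exact (hσ τ' (by simp [h])).imp_left fun h => h.mono hs₁
            · refine ⟨⟨hm, ⟨hF₁ hm, Or.inr rfl, rfl⟩, fun h => ?_⟩, le_rfl⟩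
              change l ≤ 1 at h
              omega
            · exact (hσ τ' (by simp [h])).imp_left fun h => h.mono hs₁)
            (by simp; omega)
          simp only [List.map_append, List.map_cons, List.sum_append, List.sum_cons, label_leaf,
            rk_sep] at htr
          have hsum : ∀ ys : List (SepWord T),
              List.Forall₂ (fun y (τ : LabTree (RankedLanguage T) T) => y ∈ τ.label.lang) ys σ₁ →
              (ys.map seps).sum = (σ₁.map fun τ => τ.label.rk).sum := by
            intro ys hys
            clear * - hys
            induction hys with
            | nil => rfl
            | cons h _ ih => simp [ih, seps_eq _ _ h]
          have hσv : List.Forall₂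
              (fun y (τ : LabTree (RankedLanguage T) T) => y ∈ τ.label.lang)
              (σ₁.map LabTree.value) σ₁ := by
            rw [List.forall₂_map_left_iff, List.forall₂_same]
            exact fun τ' hτ' => (hσ τ' (by simp [hτ'])).1.sound.value_mem
          refine ⟨_, ht.wrap (h2.mono hs₂) (j := (σ₁.map fun τ => τ.label.rk).sum + 1)
            (by omega) (by omega) (by omega) hF₃, ?_, ?_, ?_⟩
          · rw [value_wrap, htv, List.map_append, List.map_cons,
              show (leaf RankedLanguage.sep Term.sep : LabTree (RankedLanguage T) T).value =
                [none] from rfl,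
              intercalate_fillSeps _ (by rw [ha.seps_value]; simp; omega) (by rw [hsum _ hσv]),
              List.map_append, List.map_cons]
          · change _ + _ - 1 = _
            simp
            omega
          · rintro _ ⟨⟨u, hu, v, hv, rfl⟩, -⟩
            obtain ⟨x, hx, ys, hys, rfl⟩ := htl u hu
            obtain ⟨ys₁, ys', rfl, hys₁, hys'⟩ := forall₂_append_right hys
            obtain ⟨y, ys₃, hy, hys₃, rfl⟩ := List.forall₂_cons_right_iff.1 hys'
            obtain rfl : y = [none] := hy
            have e1 := hys₁.length_eq
            have e3 := hys₃.length_eq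
            refine ⟨x, hx, ys₁ ++ v :: ys₃, forall₂_append hys₁ (.cons hv hys₃), ?_⟩
            rw [intercalate_fillSeps _ (by rw [a.label.seps_eq x hx]; omega)
              (by rw [hsum _ hys₁])]
      obtain ⟨t, ht, htv, htr, htl⟩ := hfill
      refine ⟨t, ht.mono (by omega), ?_, ?_, ?_⟩
      · rw [htv, value_wrap, List.map_append, List.map_append, List.map_append, List.map_cons, h2v,
          fillSeps_intercalate (by rw [ha.seps_value]; simp; omega) (by simp; omega)
            (by rw [hb.seps_value]; simpa)]
      · rw [htr]; simp [h2r]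
      · intro w hw
        obtain ⟨x, hx, ys, hys, rfl⟩ := htl w hw
        obtain ⟨ys₁, ys', rfl, hys₁, hys'⟩ := forall₂_append_right hys
        obtain ⟨y, ys₃, hy, hys₃, rfl⟩ := List.forall₂_cons_right_iff.1 hys'
        obtain ⟨x', hx', ys₂, hys₂, rfl⟩ := h2l y hy
        have e1 := hys₁.length_eq
        have e2 := hys₂.length_eq
        have e3 := hys₃.length_eq
        refine ⟨_, hl x hx x' hx', ys₁ ++ (ys₂ ++ ys₃),
          forall₂_append hys₁ (forall₂_append hys₂ hys₃), ?_⟩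
        rw [fillSeps_intercalate (by rw [a.label.seps_eq x hx]; omega) (by omega)
          (by rw [b.label.seps_eq x' hx']; omega)]

end Flattening

end Displacement

namespace Displacement

open LabTree RankedLanguage

/-! ### Removing the shallow components of one rank -/

section Deepening

variable {T : Type u}

/-- Shallow components of rank `l` can be flattened at the price of finitely many additional
labels of rank less than `l`. -/
lemma exists_noShallow (F : Set (RankedLanguage T)) (n : ℕ → ℕ) {l : ℕ} (hl0 : 0 < l) :
    ∃ s, ∀ (t : LabTree (RankedLanguage T) T) (q : ℕ), t.Sound F →
      t.NoShallow RankedLanguage.rk n (l + 1) q →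
      (t.label.rk = l → q < l → t.Reaches RankedLanguage.rk l (n l)) →
      ∃ t' : LabTree (RankedLanguage T) T, t'.label = t.label ∧ t'.value = t.value ∧
        t'.Sound (F ∪ smallClosure F l s) ∧ t'.NoShallow RankedLanguage.rk n l q ∧
        (l ≤ t.label.rk → ∀ m, t.Reaches RankedLanguage.rk t.label.rk m →
          t'.Reaches RankedLanguage.rk t.label.rk m) := by
  obtain ⟨s, -, hs⟩ := exists_fill_shallow F l (n l) 0
  refine ⟨s, fun t => ?_⟩
  set F' := F ∪ smallClosure F l s with hF'
  -- rebuilding a node above two transformed subtrees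
  have rebuild : ∀ (t a b t' a' b' : LabTree (RankedLanguage T) T) (q : ℕ),
      t.children = [a, b] → t'.children = [a', b'] → t'.label = t.label →
      a'.label = a.label → b'.label = b.label →
      t.NoShallow RankedLanguage.rk n (l + 1) q →
      (t.label.rk = l → q < l → t.Reaches RankedLanguage.rk l (n l)) →
      a'.NoShallow RankedLanguage.rk n l t.label.rk →
      b'.NoShallow RankedLanguage.rk n l t.label.rk →
      (l ≤ a.label.rk → ∀ m, a.Reaches RankedLanguage.rk a.label.rk m →
        a'.Reaches RankedLanguage.rk a.label.rk m) →
      (l ≤ b.label.rk → ∀ m, b.Reaches RankedLanguage.rk b.label.rk m →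
        b'.Reaches RankedLanguage.rk b.label.rk m) →
      t'.NoShallow RankedLanguage.rk n l q ∧
        (l ≤ t.label.rk → ∀ m, t.Reaches RankedLanguage.rk t.label.rk m →
          t'.Reaches RankedLanguage.rk t.label.rk m) := by
    intro t a b t' a' b' q ht ht' hlab ha hb hn hr hna hnb hra hrb
    have hreach : l ≤ t.label.rk → ∀ m, t.Reaches RankedLanguage.rk t.label.rk m →
        t'.Reaches RankedLanguage.rk t.label.rk m := by
      intro hle m hm
      cases m with
      | zero => trivial
      | succ m =>
        obtain ⟨c, hc, h⟩ := hm
        rw [ht] at hc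
        simp only [List.mem_cons, List.not_mem_nil, or_false] at hc
        rcases hc with rfl | rfl
        · refine ⟨a', by simp [ht'], ?_⟩
          rw [ha]
          rcases h with h | ⟨h1, h2⟩
          · exact Or.inl h
          · rw [← h1] at h2 hle ⊢
            exact Or.inr ⟨rfl, hra hle m h2⟩
        · refine ⟨b', by simp [ht'], ?_⟩
          rw [hb]
          rcases h with h | ⟨h1, h2⟩
          · exact Or.inl h
          · rw [← h1] at h2 hle ⊢
            exact Or.inr ⟨rfl, hrb hle m h2⟩
    refine ⟨noShallow_iff.2 ⟨fun h1 h2 => ?_, ?_⟩, hreach⟩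
    · rw [hlab] at h1 h2 ⊢
      refine hreach h1 _ ?_
      rcases h1.lt_or_eq with h1 | h1
      · exact (noShallow_iff.1 hn).1 h1 h2
      · rw [← h1]; exact hr h1.symm (h1 ▸ h2)
    · rw [ht', hlab]
      simp [hna, hnb]
  induction hN : sizeOf t using Nat.strong_induction_on generalizing t with
  | _ N ih =>
  subst hN
  intro q ht hn hr
  have hchildn := (noShallow_iff.1 hn).2
  cases t with
  | leaf A x =>
    refine ⟨_, rfl, rfl, ht.mono Set.subset_union_left, fun h1 h2 => ?_, fun _ _ h => h⟩
    rcases Nat.lt_or_ge l A.rk with h | h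
    · exact hn h h2
    · obtain rfl : A.rk = l := le_antisymm h h1
      exact hr rfl h2
  | concat A a b =>
    obtain ⟨hA, hrk, hl, ha, hb⟩ := ht
    obtain ⟨a', ha1, ha2, ha3, ha4, ha5⟩ := ih (sizeOf a) (by simp; omega) a rfl A.rk ha
      (hchildn a (by simp [children])) (fun _ _ => by omega)
    obtain ⟨b', hb1, hb2, hb3, hb4, hb5⟩ := ih (sizeOf b) (by simp) b rfl A.rk hb
      (hchildn b (by simp [children])) (fun _ _ => by omega)
    refine ⟨.concat A a' b', rfl, by simp [ha2, hb2], ⟨Or.inl hA, ?_, ?_, ha3, hb3⟩,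
      rebuild _ a b _ a' b' q rfl rfl rfl ha1 hb1 hn hr ha4 hb4 ha5 hb5⟩
    · rw [ha1, hb1]; exact hrk
    · rw [ha1, hb1]; exact hl
  | wrap A j a b =>
    obtain ⟨hA, hrk, ⟨hj1, hj⟩, hl, ha, hb⟩ := ht
    have hna := hchildn a (by simp [children])
    obtain ⟨b', hb1, hb2, hb3, hb4, hb5⟩ := ih (sizeOf b) (by simp) b rfl A.rk hb
      (hchildn b (by simp [children])) (fun _ _ => by omega)
    -- Only the left operand of an intercalation can have larger rank than its parent, so this is
    -- the only place where the root of a shallow component can occur below another node.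
    by_cases hbad : a.label.rk = l → A.rk < l → a.Reaches RankedLanguage.rk l (n l)
    · obtain ⟨a', ha1, ha2, ha3, ha4, ha5⟩ := ih (sizeOf a) (by simp; omega) a rfl A.rk ha
        hna hbad
      refine ⟨.wrap A j a' b', rfl, by simp [ha2, hb2],
        ⟨Or.inl hA, ?_, ⟨hj1, by rwa [ha1]⟩, ?_, ha3, hb3⟩,
        rebuild _ a b _ a' b' q rfl rfl rfl ha1 hb1 hn hr ha4 hb4 ha5 hb5⟩
      · rw [ha1, hb1]; exact hrk
      · rw [ha1, hb1]; exact hl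
    · push Not at hbad
      obtain ⟨hal, hAl, har⟩ := hbad
      have hb0 : b.label.rk = 0 := by omega
      have hbs : SmallTree F' n l (smallClosure F l 0) b' :=
        ⟨⟨Or.inr (hb1 ▸ hb.label_mem), by rw [hb1]; omega⟩, hb3,
          hb4.of_rank_lt (by rw [hb1]; omega) 0⟩
      have hseps : 1 < l → SmallTree F' n l (smallClosure F l 0)
          (.leaf RankedLanguage.sep .sep) := fun h1 =>
        have hm : RankedLanguage.sep ∈ smallClosure F l 0 := ⟨Set.mem_insert _ _, h1⟩
        ⟨hm, ⟨Or.inr (smallClosure_mono (Nat.zero_le _) hm), Or.inr rfl, rfl⟩,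
          fun h => absurd h (Nat.not_le.2 h1)⟩
      -- The component is filled with `b'` at position `j` and with separators elsewhere. These `l`
      -- fillers have total rank `l - 1`, as required for flattening.
      obtain ⟨t, h1, h2, h3, h4⟩ := hs F' n Set.subset_union_right a _ ha (Or.inr ⟨hal, har⟩) hna
        (fun d q' hd hdF hdl hdn => by
          obtain ⟨d', h1, h2, h3, h4, -⟩ := ih (sizeOf d) (by simp; omega) d rfl q' hdF hdn
            (fun h => absurd h hdl.ne)
          exact ⟨d', h1, h2, h3, h4.of_rank_lt (h1 ▸ hdl) 0⟩)
        (List.replicate (j - 1) (.leaf RankedLanguage.sep .sep) ++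
          b' :: List.replicate (l - j) (.leaf RankedLanguage.sep .sep))
        (by simp; omega)
        (fun τ hτ => by
          simp only [List.mem_append, List.mem_cons, List.mem_replicate] at hτ
          rcases hτ with ⟨h, rfl⟩ | rfl | ⟨h, rfl⟩
          · exact ⟨hseps (by omega), le_rfl⟩
          · exact ⟨hbs, by rw [hb1]; omega⟩
          · exact ⟨hseps (by omega), le_rfl⟩)
        (by simp [hb1, hb0]; omega)
      have hwrap : ∀ x y : SepWord T, seps x = l →
          fillSeps x (List.replicate (j - 1) [none] ++ y :: List.replicate (l - j) [none]) =
            intercalate j x y := by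
        intro x y hx
        rw [fillSeps_keep_others y (by omega), Nat.sub_add_cancel hj1]
      have htr : A.rk = t.label.rk := by rw [h3]; simp [hb1, hb0]; omega
      -- The flattened tree replaces the whole intercalation node and takes over its label `A`, so
      -- nothing changes above it. Preservation of `Reaches` is vacuous, since `A` has rank below
      -- `l`.
      refine ⟨t.relabel A, by simp, ?_, h1.sound.relabel (Or.inl hA) htr ?_,
        (h1.noShallow.of_rank_lt h1.rk_lt q).relabel htr, fun h => ?_⟩
      · rw [value_relabel, h2, value_wrap, List.map_append, List.map_cons, List.map_replicate,
          List.map_replicate, hb2,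
          show (leaf RankedLanguage.sep Term.sep : LabTree (RankedLanguage T) T).value =
            [none] from rfl, hwrap _ _ (by rw [ha.seps_value, hal])]
      · intro w hw
        obtain ⟨x, hx, ys, hys, rfl⟩ := h4 w hw
        have hrep : ∀ (m : ℕ) (ys : List (SepWord T)),
            List.Forall₂ (fun y (τ : LabTree (RankedLanguage T) T) => y ∈ τ.label.lang) ys
              (List.replicate m (.leaf RankedLanguage.sep .sep)) →
            ys = List.replicate m [none] := by
          intro m
          induction m with
          | zero => intro ys h; simpa using h
          | succ m ihm =>
            intro ys h
            obtain ⟨y, ys', hy, hys', rfl⟩ := List.forall₂_cons_right_iff.1 h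
            rw [ihm ys' hys', List.replicate_succ, show y = [none] from hy]
        obtain ⟨ys₁, ys', rfl, hys₁, hys'⟩ := forall₂_append_right hys
        obtain ⟨y, ys₃, hy, hys₃, rfl⟩ := List.forall₂_cons_right_iff.1 hys'
        rw [hrep _ _ hys₁, hrep _ _ hys₃, hwrap x y ((a.label.seps_eq x hx).trans hal)]
        exact hl x hx y (hb1 ▸ hy)
      · exact absurd h (Nat.not_le.2 hAl)

/-- The number of languages of rank `r` in a family. -/
noncomputable def rankCount (F : Set (RankedLanguage T)) (r : ℕ) : ℕ := {A ∈ F | A.rk = r}.ncard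

/-- `L` is generated by a finite family of languages of rank at most `k` via sound trees that have
no shallow components of rank greater than `l`. -/
def GeneratedWithoutShallow (k : ℕ) (L : Set (SepWord T)) (l : ℕ) : Prop :=
  ∃ F : Set (RankedLanguage T), F.Finite ∧ (∀ A ∈ F, A.rk ≤ k) ∧
    ∃ A₀ ∈ F, A₀.rk = 0 ∧ A₀.lang ⊆ L ∧ ∀ w ∈ L, w ≠ [] →
      ∃ t : LabTree (RankedLanguage T) T, t.Sound F ∧ t.label = A₀ ∧ t.value = w ∧
        t.NoShallow RankedLanguage.rk (rankCount F) (l + 1) 0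

/-- Flattening rank `l + 1` adds only labels of rank at most `l`. The counts that define shallowness
in ranks above `l` are therefore the same for the old and the new family. -/
lemma GeneratedWithoutShallow.succ {k : ℕ} {L : Set (SepWord T)} {l : ℕ} (hl : l + 1 ≤ k)
    (h : GeneratedWithoutShallow k L (l + 1)) : GeneratedWithoutShallow k L l := by
  obtain ⟨F, hF, hFk, A₀, hA₀, hA₀r, hA₀L, h⟩ := h
  obtain ⟨s, hs⟩ := exists_noShallow F (rankCount F) (Nat.succ_pos l)
  refine ⟨_, hF.union (finite_smallClosure (l := l + 1) hF s), ?_, A₀, Or.inl hA₀, hA₀r, hA₀L,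
    fun w hw hw0 => ?_⟩
  · rintro A (hA | hA)
    · exact hFk A hA
    · have := rk_lt_of_mem_smallClosure hA; omega
  · obtain ⟨t, ht, htA, htw, htn⟩ := h w hw hw0
    obtain ⟨t', h1, h2, h3, h4, -⟩ := hs t 0 ht htn (fun h => by rw [htA] at h; omega)
    refine ⟨t', h3, h1.trans htA, h2.trans htw, h4.congr fun r hr => ?_⟩
    rw [rankCount, rankCount]
    congr 1
    ext A
    simp only [Set.mem_ofPred_eq, Set.mem_union, and_congr_left_iff]
    rintro rfl
    refine ⟨Or.inl, fun h => h.resolve_right fun h => ?_⟩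
    have := rk_lt_of_mem_smallClosure h
    omega

end Deepening

end Displacement

/-! ### Subterms of right-hand sides -/

namespace Displacement

open LabTree RankedLanguage

namespace Term

variable {N : Type v} {T : Type u}

/-- The subterms of a term; the subterms of a word are all its scattered subwords. -/
def parts : Term N T → Set (Term N T)
  | nt A => {nt A}
  | word w => word '' {v | v.Sublist w}
  | sep => {sep}
  | concat α β => insert (concat α β) (parts α ∪ parts β)
  | wrap j α β => insert (wrap j α β) (parts α ∪ parts β)

lemma mem_parts_self (α : Term N T) : α ∈ α.parts := by
  cases α <;> simp [parts]

lemma parts_subset {α β : Term N T} (h : α ∈ β.parts) : α.parts ⊆ β.parts := by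
  induction β with
  | nt A => obtain rfl := h; rfl
  | word w =>
    obtain ⟨v, hv, rfl⟩ := h
    rintro _ ⟨v', hv', rfl⟩
    exact ⟨v', List.Sublist.trans hv' hv, rfl⟩
  | sep => obtain rfl := h; rfl
  | concat β γ ihβ ihγ =>
    rcases h with rfl | h | h
    · rfl
    · exact (ihβ h).trans fun x hx => Or.inr (Or.inl hx)
    · exact (ihγ h).trans fun x hx => Or.inr (Or.inr hx)
  | wrap j β γ ihβ ihγ =>
    rcases h with rfl | h | h
    · rfl
    · exact (ihβ h).trans fun x hx => Or.inr (Or.inl hx)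
    · exact (ihγ h).trans fun x hx => Or.inr (Or.inr hx)

lemma finite_parts (α : Term N T) : α.parts.Finite := by
  induction α with
  | nt A => exact Set.finite_singleton _
  | word w =>
    refine Set.Finite.image _ ((List.finite_toSet w.sublists).subset fun v hv => ?_)
    exact List.mem_sublists.2 hv
  | sep => exact Set.finite_singleton _
  | concat β γ ihβ ihγ => exact (ihβ.union ihγ).insert _
  | wrap j β γ ihβ ihγ => exact (ihβ.union ihγ).insert _

/-- The maximum is needed because the separator is correct and has rank 1 even for `k = 0`. -/
lemma Correct.rank_le {rk : N → ℕ} {k : ℕ} {α : Term N T} (h : α.Correct rk k) :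
    α.rank rk ≤ max k 1 := by
  cases α <;> simp only [Correct, rank] at h ⊢ <;> omega

lemma Correct.of_mem_parts {rk : N → ℕ} {k : ℕ} {α β : Term N T} (h : α ∈ β.parts)
    (hβ : β.Correct rk k) (hr : β.rank rk ≤ k) : α.Correct rk k ∧ α.rank rk ≤ k := by
  induction β with
  | nt A => obtain rfl := h; exact ⟨hβ, hr⟩
  | word w => obtain ⟨v, hv, rfl⟩ := h; exact ⟨trivial, Nat.zero_le _⟩
  | sep => obtain rfl := h; exact ⟨hβ, hr⟩
  | concat β γ ihβ ihγ =>
    rcases h with rfl | h | h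
    · exact ⟨hβ, hr⟩
    · exact ihβ h hβ.1 (by have := hβ.2.2; omega)
    · exact ihγ h hβ.2.1 (by have := hβ.2.2; omega)
  | wrap j β γ ihβ ihγ =>
    rcases h with rfl | h | h
    · exact ⟨hβ, hr⟩
    · obtain ⟨h1, h2, h3, h4, h5, h6⟩ := hβ
      exact ihβ h h1 (by have := h1.rank_le; omega)
    · obtain ⟨h1, h2, h3, h4, h5, h6⟩ := hβ
      exact ihγ h h2 (by omega)

end Term

/-! ### Big-step semantics and elimination of empty words -/

namespace DCFG

variable {T : Type u} {k : ℕ} (G : DCFG.{u, v} T k)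

/-- Big-step semantics: the words obtained from a term by replacing nonterminals by words
derivable from them. -/
inductive Yields : Term G.NT T → SepWord T → Prop
  | nt {A : G.NT} {α : Term G.NT T} {w : SepWord T} (hA : (A, α) ∈ G.rules) (h : Yields α w) :
      Yields (.nt A) w
  | word (w : List T) : Yields (.word w) (w.map some)
  | sep : Yields .sep [none]
  | concat {α β : Term G.NT T} {x y : SepWord T} (hα : Yields α x) (hβ : Yields β y) :
      Yields (.concat α β) (x ++ y)
  | wrap {j : ℕ} {α β : Term G.NT T} {x y : SepWord T} (hα : Yields α x) (hβ : Yields β y) :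
      Yields (.wrap j α β) (intercalate j x y)

variable {G}

lemma yields_value {α : Term G.NT T} (h : α.Ground) : G.Yields α α.value := by
  induction α with
  | nt A => exact h.elim
  | word w => exact .word w
  | sep => exact .sep
  | concat α β ihα ihβ => exact .concat (ihα h.1) (ihβ h.2)
  | wrap j α β ihα ihβ => exact .wrap (ihα h.1) (ihβ h.2)

lemma Yields.of_fill {C : Context G.NT T} {α β : Term G.NT T}
    (h : ∀ w, G.Yields β w → G.Yields α w) {w : SepWord T} (hw : G.Yields (C.fill β) w) :
    G.Yields (C.fill α) w := by
  induction C generalizing w with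
  | hole => exact h w hw
  | concatLeft C γ ih => obtain _ | _ | _ | ⟨h1, h2⟩ := hw; exact .concat (ih h1) h2
  | concatRight γ C ih => obtain _ | _ | _ | ⟨h1, h2⟩ := hw; exact .concat h1 (ih h2)
  | wrapLeft j C γ ih => obtain _ | _ | _ | _ | ⟨h1, h2⟩ := hw; exact .wrap (ih h1) h2
  | wrapRight j γ C ih => obtain _ | _ | _ | _ | ⟨h1, h2⟩ := hw; exact .wrap h1 (ih h2)

lemma reflTransGen_fill (C : Context G.NT T) (hC : ∀ C' : Context G.NT T, ∃ C'' : Context G.NT T,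
    ∀ γ, C''.fill γ = C.fill (C'.fill γ)) {α β : Term G.NT T}
    (h : Relation.ReflTransGen G.Step α β) :
    Relation.ReflTransGen G.Step (C.fill α) (C.fill β) := by
  refine h.lift _ ?_
  rintro _ _ ⟨C', B, γ, hB, rfl, rfl⟩
  obtain ⟨C'', hC''⟩ := hC C'
  exact ⟨C'', B, γ, hB, (hC'' _).symm, (hC'' _).symm⟩

lemma Yields.exists_ground {α : Term G.NT T} {w : SepWord T} (h : G.Yields α w) :
    ∃ β, Relation.ReflTransGen G.Step α β ∧ β.Ground ∧ β.value = w := by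
  induction h with
  | nt hA _ ih =>
    obtain ⟨β, h1, h2⟩ := ih
    exact ⟨β, .head ⟨.hole, _, _, hA, rfl, rfl⟩ h1, h2⟩
  | word w => exact ⟨_, .refl, trivial, rfl⟩
  | sep => exact ⟨_, .refl, trivial, rfl⟩
  | @concat α β _ _ _ _ ihα ihβ =>
    obtain ⟨α', h1, h2, rfl⟩ := ihα
    obtain ⟨β', h3, h4, rfl⟩ := ihβ
    exact ⟨.concat α' β', (reflTransGen_fill (.concatLeft .hole β)
      (fun C => ⟨.concatLeft C β, fun _ => rfl⟩) h1).trans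
      (reflTransGen_fill (.concatRight α' .hole)
      (fun C => ⟨.concatRight α' C, fun _ => rfl⟩) h3), ⟨h2, h4⟩, rfl⟩
  | @wrap j α β _ _ _ _ ihα ihβ =>
    obtain ⟨α', h1, h2, rfl⟩ := ihα
    obtain ⟨β', h3, h4, rfl⟩ := ihβ
    exact ⟨.wrap j α' β', (reflTransGen_fill (.wrapLeft j .hole β)
      (fun C => ⟨.wrapLeft j C β, fun _ => rfl⟩) h1).trans
      (reflTransGen_fill (.wrapRight j α' .hole)
      (fun C => ⟨.wrapRight j α' C, fun _ => rfl⟩) h3), ⟨h2, h4⟩, rfl⟩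

lemma mem_languageOf_iff {A : G.NT} {w : SepWord T} :
    w ∈ G.languageOf A ↔ G.Yields (.nt A) w := by
  constructor
  · rintro ⟨α, h, hα, rfl⟩
    have hy := yields_value hα
    revert hy
    generalize α.value = w
    intro hy
    change Relation.ReflTransGen G.Step _ _ at h
    generalize Term.nt A = β at h ⊢
    -- The derivation is read backwards from its ground term: undoing a rewriting step keeps every
    -- yielded word.
    induction h using Relation.ReflTransGen.head_induction_on with
    | refl => exact hy
    | head h _ ih =>
      obtain ⟨C, B, β, hB, rfl, rfl⟩ := h
      exact Yields.of_fill (fun w hw => .nt hB hw) ih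
  · intro h
    exact h.exists_ground

lemma Yields.seps_eq {α : Term G.NT T} {w : SepWord T} (h : G.Yields α w)
    (hα : α.Correct G.rk k) : seps w = α.rank G.rk := by
  induction h with
  | nt hA _ ih => exact (ih (G.correct_rules _ _ hA)).trans (G.rank_rules _ _ hA)
  | word w => simp [Term.rank]
  | sep => simp [Term.rank]
  | concat _ _ ihα ihβ => simp [Term.rank, ihα hα.1, ihβ hα.2.1]
  | @wrap j α β x y _ _ ihα ihβ =>
    obtain ⟨h1, h2, h3, h4, h5, h6⟩ := hα
    have := seps_intercalate (x := x) h3 (ihα h1 ▸ h6) y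
    rw [ihα h1, ihβ h2] at this
    rw [Term.rank, ← this, Nat.add_sub_cancel]

variable (G)

/-- The words yielded by a term, with the separators marked by `false` in `b` deleted. -/
def erasedLanguage (β : Term G.NT T) (b : List Bool) : RankedLanguage T :=
  ⟨b.count true, {w | ∃ x, G.Yields β x ∧ b.length = seps x ∧ eraseSeps b x = w}, by
    rintro _ ⟨x, -, h, rfl⟩
    exact seps_eraseSeps h⟩

/-- The nonterminals and the subterms of right-hand sides. -/
def subterms : Set (Term G.NT T) := Set.range .nt ∪ ⋃ p ∈ G.rules, p.2.parts

/-- All erased languages of subterms. -/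
def erasedLanguages : Set (RankedLanguage T) :=
  Set.image2 G.erasedLanguage G.subterms {b | b.length ≤ k}

variable {G}

lemma finite_subterms : G.subterms.Finite := by
  have := G.finite_NT
  exact (Set.finite_range _).union (G.finite_rules.biUnion fun p _ => p.2.finite_parts)

lemma finite_erasedLanguages : G.erasedLanguages.Finite :=
  finite_subterms.image2 _ (List.finite_length_le _ _)

lemma mem_subterms_of_mem_parts {α β : Term G.NT T} (hβ : β ∈ G.subterms) (h : α ∈ β.parts) :
    α ∈ G.subterms := by
  rcases hβ with ⟨A, rfl⟩ | hβ
  · obtain rfl := h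
    exact Or.inl ⟨A, rfl⟩
  · simp only [Set.mem_iUnion] at hβ
    obtain ⟨p, hp, hβ⟩ := hβ
    exact Or.inr (Set.mem_biUnion hp (Term.parts_subset hβ h))

lemma correct_of_mem_subterms {β : Term G.NT T} (hβ : β ∈ G.subterms) :
    β.Correct G.rk k ∧ β.rank G.rk ≤ k := by
  rcases hβ with ⟨A, rfl⟩ | hβ
  · exact ⟨G.rk_le A, G.rk_le A⟩
  · simp only [Set.mem_iUnion] at hβ
    obtain ⟨⟨A, α⟩, hp, hβ⟩ := hβ
    exact Term.Correct.of_mem_parts hβ (G.correct_rules _ _ hp) (G.rank_rules _ _ hp ▸ G.rk_le A)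

lemma Yields.erasedLanguage_mem {β : Term G.NT T} {w : SepWord T} (h : G.Yields β w)
    (hβ : β ∈ G.subterms) {b : List Bool} (hb : b.length = seps w) :
    G.erasedLanguage β b ∈ G.erasedLanguages := by
  obtain ⟨h1, h2⟩ := correct_of_mem_subterms hβ
  refine Set.mem_image2_of_mem hβ ?_
  rw [← h.seps_eq h1, ← hb] at h2
  exact h2

lemma exists_sound_word (w : List T) (hw : (.word w : Term G.NT T) ∈ G.subterms) (h0 : w ≠ []) :
    ∃ t : LabTree (RankedLanguage T) T, t.Sound G.erasedLanguages ∧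
      t.label = G.erasedLanguage (.word w) [] ∧ t.value = w.map some := by
  have hmem : ∀ w : List T, w.map some ∈ (G.erasedLanguage (.word w) []).lang := fun w =>
    ⟨_, .word w, by simp, eraseSeps_of_seps_eq_zero (by simp)⟩
  have heq : ∀ (w : List T) (x : SepWord T), x ∈ (G.erasedLanguage (.word w) []).lang →
      x = w.map some := by
    rintro w _ ⟨x, hx, -, rfl⟩
    obtain _ | _ := hx
    exact eraseSeps_of_seps_eq_zero (by simp)
  induction w with
  | nil => exact absurd rfl h0
  | cons a w ih =>
    have ha : (.word [a] : Term G.NT T) ∈ G.subterms :=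
      mem_subterms_of_mem_parts hw ⟨[a], by simp, rfl⟩
    have hleaf : (leaf (G.erasedLanguage (.word [a]) []) (.word [a])).Sound G.erasedLanguages :=
      ⟨(Yields.word [a]).erasedLanguage_mem ha (by simp), Or.inl ⟨a, rfl⟩, hmem [a]⟩
    rcases eq_or_ne w [] with rfl | hw0
    · exact ⟨_, hleaf, rfl, rfl⟩
    · obtain ⟨t, ht, htl, htw⟩ := ih
        (mem_subterms_of_mem_parts hw ⟨w, List.sublist_cons_self _ _, rfl⟩) hw0
      refine ⟨.concat (G.erasedLanguage (.word (a :: w)) []) (leaf _ (.word [a])) t,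
        ⟨(Yields.word _).erasedLanguage_mem hw (by simp), ?_, ?_, hleaf, ht⟩, rfl, ?_⟩
      · simp [htl, erasedLanguage]
      · intro x hx y hy
        rw [htl] at hy
        rw [heq _ x hx, heq _ y hy]
        exact hmem (a :: w)
      · rw [value_concat, htw]; rfl

/-- The mask `b` is generalized in the induction. Whenever one operand becomes empty after erasure,
its node is dropped and the tree of the other operand is relabelled, so no leaf carries the empty
word. -/
lemma Yields.exists_sound {β : Term G.NT T} {w : SepWord T} (h : G.Yields β w)
    (hβ : β ∈ G.subterms) {b : List Bool} (hb : b.length = seps w) (h0 : eraseSeps b w ≠ []) :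
    ∃ t : LabTree (RankedLanguage T) T, t.Sound G.erasedLanguages ∧
      t.label = G.erasedLanguage β b ∧ t.value = eraseSeps b w := by
  have hmem := h.erasedLanguage_mem hβ hb
  induction h generalizing b with
  | @nt A α w hA h ih =>
    have hα : α ∈ G.subterms := Or.inr (Set.mem_biUnion hA α.mem_parts_self)
    obtain ⟨t, h1, h2, h3⟩ := ih hα hb h0 (h.erasedLanguage_mem hα hb)
    refine ⟨t.relabel (G.erasedLanguage (.nt A) b), h1.relabel hmem (by rw [h2]; rfl) ?_,
      by simp, by simpa using h3⟩
    rw [h2]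
    rintro _ ⟨x, hx, h⟩
    exact ⟨x, .nt hA hx, h⟩
  | word w =>
    obtain rfl : b = [] := by simpa using hb
    rw [eraseSeps_of_seps_eq_zero (by simp)] at h0 ⊢
    exact exists_sound_word w hβ (by simpa using h0)
  | sep =>
    obtain ⟨c, rfl⟩ := List.length_eq_one_iff.1 hb
    cases c with
    | false => exact absurd rfl h0
    | true =>
      exact ⟨leaf (G.erasedLanguage .sep [true]) .sep,
        ⟨hmem, Or.inr rfl, ⟨_, .sep, hb, rfl⟩⟩, rfl, rfl⟩
  | @concat α β x y hα' hβ' ihα ihβ =>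
    have hα : α ∈ G.subterms :=
      mem_subterms_of_mem_parts hβ (Or.inr (Or.inl α.mem_parts_self))
    replace hβ : β ∈ G.subterms :=
      mem_subterms_of_mem_parts hβ (Or.inr (Or.inr β.mem_parts_self))
    obtain ⟨b₁, b₂, rfl, hb₁, hb₂⟩ := exists_append_of_length (hb.trans (seps_append x y))
    replace ihα := fun h => ihα hα hb₁ h (hα'.erasedLanguage_mem hα hb₁)
    replace ihβ := fun h => ihβ hβ hb₂ h (hβ'.erasedLanguage_mem hβ hb₂)
    have c₁ := seps_eraseSeps hb₁
    have c₂ := seps_eraseSeps hb₂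
    have hcont : ∀ u ∈ (G.erasedLanguage α b₁).lang, ∀ v ∈ (G.erasedLanguage β b₂).lang,
        u ++ v ∈ (G.erasedLanguage (.concat α β) (b₁ ++ b₂)).lang := by
      rintro _ ⟨u, hu, hu', rfl⟩ _ ⟨v, hv, hv', rfl⟩
      exact ⟨u ++ v, .concat hu hv, by simp [hu', hv'], eraseSeps_append hu' _ _⟩
    have hx : eraseSeps b₁ x ∈ (G.erasedLanguage α b₁).lang := ⟨x, hα', hb₁, rfl⟩
    have hy : eraseSeps b₂ y ∈ (G.erasedLanguage β b₂).lang := ⟨y, hβ', hb₂, rfl⟩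
    rw [eraseSeps_append hb₁] at h0 ⊢
    rcases eq_or_ne (eraseSeps b₁ x) [] with e₁ | e₁
    · rw [e₁] at h0 c₁ hx ⊢
      obtain ⟨t, h1, h2, h3⟩ := ihβ (by simpa using h0)
      refine ⟨t.relabel (G.erasedLanguage (.concat α β) (b₁ ++ b₂)), h1.relabel hmem ?_ ?_,
        by simp, by simpa using h3⟩
      · rw [h2]
        simp only [erasedLanguage, List.count_append, ← c₁, seps_nil, zero_add]
      · rw [h2]
        exact fun v hv => hcont _ hx v hv
    rcases eq_or_ne (eraseSeps b₂ y) [] with e₂ | e₂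
    · rw [e₂] at h0 c₂ hy ⊢
      obtain ⟨t, h1, h2, h3⟩ := ihα (by simpa using h0)
      refine ⟨t.relabel (G.erasedLanguage (.concat α β) (b₁ ++ b₂)), h1.relabel hmem ?_ ?_,
        by simp, by simpa using h3⟩
      · rw [h2]
        simp only [erasedLanguage, List.count_append, ← c₂, seps_nil, add_zero]
      · rw [h2]
        exact fun u hu => by simpa using hcont u hu _ hy
    obtain ⟨t, h1, h2, h3⟩ := ihα e₁
    obtain ⟨t', h1', h2', h3'⟩ := ihβ e₂
    refine ⟨.concat (G.erasedLanguage (.concat α β) (b₁ ++ b₂)) t t', ⟨hmem, ?_, ?_, h1, h1'⟩,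
      rfl, by simp [h3, h3']⟩
    · rw [h2, h2']
      simp only [erasedLanguage, List.count_append]
    · rw [h2, h2']
      exact hcont
  | @wrap j α β x y hα' hβ' ihα ihβ =>
    obtain ⟨k1, k2, hj1, k4, k5, hj⟩ := (correct_of_mem_subterms hβ).1
    have hα : α ∈ G.subterms :=
      mem_subterms_of_mem_parts hβ (Or.inr (Or.inl α.mem_parts_self))
    replace hβ : β ∈ G.subterms :=
      mem_subterms_of_mem_parts hβ (Or.inr (Or.inr β.mem_parts_self))
    have hjx : j ≤ seps x := by rwa [hα'.seps_eq k1]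
    have hsep := seps_intercalate hj1 hjx y
    obtain ⟨b₁, b', rfl, hb₁, hb'⟩ := exists_append_of_length (l := b) (m := j - 1)
      (n := seps y + (seps x - j)) (by omega)
    obtain ⟨b₂, b₃, rfl, hb₂, hb₃⟩ := exists_append_of_length hb'
    replace ihβ := fun h => ihβ hβ hb₂ h (hβ'.erasedLanguage_mem hβ hb₂)
    replace ihα := fun (c : Bool) h => ihα (b := b₁ ++ c :: b₃) hα (by simp; omega) h
      (hα'.erasedLanguage_mem hα (by simp; omega))
    have c₂ := seps_eraseSeps hb₂
    have hlen : ∀ u, G.Yields α u → ∀ v, G.Yields β v →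
        (b₁ ++ (b₂ ++ b₃)).length = seps (intercalate j u v) ∧
        b₁.length + 1 + b₃.length = seps u ∧ b₂.length = seps v := by
      intro u hu v hv
      have hux := (hu.seps_eq k1).trans (hα'.seps_eq k1).symm
      have hvy := (hv.seps_eq k2).trans (hβ'.seps_eq k2).symm
      have := seps_intercalate hj1 (hux ▸ hjx) v
      simp only [List.length_append]
      omega
    obtain ⟨-, l₁, l₂⟩ := hlen x hα' y hβ'
    rcases eq_or_ne (eraseSeps b₂ y) [] with e₂ | e₂
    · rw [eraseSeps_intercalate_erase (by omega) l₁ l₂ e₂] at h0 ⊢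
      obtain ⟨t, h1, h2, h3⟩ := ihα false h0
      refine ⟨t.relabel (G.erasedLanguage (.wrap j α β) (b₁ ++ (b₂ ++ b₃))),
        h1.relabel hmem ?_ ?_, by simp, by simpa using h3⟩
      · rw [h2]
        rw [e₂] at c₂
        simp [erasedLanguage, List.count_append, ← c₂]
      · rw [h2]
        rintro _ ⟨u, hu, -, rfl⟩
        obtain ⟨m₁, m₂, m₃⟩ := hlen u hu y hβ'
        exact ⟨_, .wrap hu hβ', m₁, eraseSeps_intercalate_erase (by omega) m₂ m₃ e₂⟩
    -- The `j`-th separator of `x` survives this mask, so the induction hypothesis applies to the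
    -- left operand.
    · have hxe : eraseSeps (b₁ ++ true :: b₃) x ≠ [] := by
        intro h
        have := seps_eraseSeps (b := b₁ ++ true :: b₃) (x := x) (by simp; omega)
        rw [h] at this
        simp at this
      obtain ⟨t, h1, h2, h3⟩ := ihα true hxe
      obtain ⟨t', h1', h2', h3'⟩ := ihβ e₂
      refine ⟨.wrap (G.erasedLanguage (.wrap j α β) (b₁ ++ (b₂ ++ b₃))) (b₁.count true + 1) t t',
        ⟨hmem, ?_, ⟨by omega, ?_⟩, ?_, h1, h1'⟩, rfl, ?_⟩
      · rw [h2, h2']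
        simp [erasedLanguage, List.count_append]
        omega
      · rw [h2]
        simp [erasedLanguage, List.count_append]
      · rw [h2, h2']
        rintro _ ⟨u, hu, -, rfl⟩ _ ⟨v, hv, -, rfl⟩
        obtain ⟨m₁, m₂, m₃⟩ := hlen u hu v hv
        exact ⟨_, .wrap hu hv, m₁, eraseSeps_intercalate_keep (by omega) m₂ m₃⟩
      · rw [value_wrap, h3, h3', eraseSeps_intercalate_keep (by omega) l₁ l₂]

end DCFG

lemma LabTree.Sound.noShallow {T : Type u} {F : Set (RankedLanguage T)} {k : ℕ}
    (hF : ∀ A ∈ F, A.rk ≤ k) {t : LabTree (RankedLanguage T) T} (ht : t.Sound F) (n : ℕ → ℕ)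
    (q : ℕ) : t.NoShallow RankedLanguage.rk n (k + 1) q := by
  have hA : ∀ A ∈ F, ¬ k + 1 ≤ A.rk := fun A hA h => by have := hF A hA; omega
  induction t generalizing q with
  | leaf A x => exact fun h => absurd h (hA _ ht.1)
  | concat A s t ihs iht =>
    exact ⟨fun h => absurd h (hA _ ht.1), ihs ht.2.2.2.1 _, iht ht.2.2.2.2 _⟩
  | wrap A j s t ihs iht =>
    exact ⟨fun h => absurd h (hA _ ht.1), ihs ht.2.2.2.2.1 _, iht ht.2.2.2.2.2 _⟩

/-- Downward induction on `l`. At `l = k` the condition is vacuous, as no label has rank above `k`.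
-/
lemma DCFG.generatedWithoutShallow {T : Type u} {k : ℕ} (G : DCFG.{u, v} T k) {l : ℕ}
    (hl : l ≤ k) : GeneratedWithoutShallow k G.language l := by
  induction hl using Nat.decreasingInduction with
  | of_succ l hl ih => exact ih.succ hl
  | self =>
    have hk : ∀ A ∈ G.erasedLanguages, A.rk ≤ k := by
      rintro _ ⟨β, -, b, hb, rfl⟩
      exact List.count_le_length.trans hb
    have hS : (.nt G.start : Term G.NT T) ∈ G.subterms := Or.inl ⟨_, rfl⟩
    have h0 : ∀ w, G.Yields (.nt G.start) w → seps w = 0 := fun w hw =>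
      (hw.seps_eq (G.rk_le G.start)).trans G.rk_start
    refine ⟨_, G.finite_erasedLanguages, hk, G.erasedLanguage (.nt G.start) [],
      Set.mem_image2_of_mem hS (Nat.zero_le _), rfl, ?_, fun w hw hw0 => ?_⟩
    · rintro _ ⟨x, hx, -, rfl⟩
      rw [eraseSeps_of_seps_eq_zero (h0 x hx)]
      exact mem_languageOf_iff.2 hx
    · replace hw := mem_languageOf_iff.1 hw
      have e := eraseSeps_of_seps_eq_zero (b := []) (h0 w hw)
      obtain ⟨t, h1, h2, h3⟩ := hw.exists_sound hS (b := []) (by simp [h0 w hw]) (by rwa [e])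
      exact ⟨t, h1, h2, h3.trans e, h1.noShallow hk _ _⟩

end Displacement

/-! ### Nodes and their subtrees -/

namespace Displacement

namespace LabTree

variable {N : Type v} {T : Type u} {t : LabTree N T}

lemma subtree_append (t : LabTree N T) (p q : List Bool) :
    t.subtree (p ++ q) = (t.subtree p).bind fun s => s.subtree q := by
  induction p generalizing t with
  | nil => simp [subtree]
  | cons b p ih => cases t <;> simp only [List.cons_append, subtree] <;> first | rfl | skip
                   all_goals split <;> exact ih _

/-- The subtree below a node. -/
def Node.tree (x : t.Node) : LabTree N T := (t.subtree x.1).get x.2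

lemma Node.subtree_eq (x : t.Node) : t.subtree x.1 = some x.tree := by
  simp [Node.tree]

lemma Node.tree_eq {x : t.Node} {s : LabTree N T} (h : t.subtree x.1 = some s) : x.tree = s := by
  rw [x.subtree_eq] at h
  exact Option.some_inj.1 h

lemma mem_children_iff {s c : LabTree N T} : c ∈ s.children ↔ ∃ b, s.subtree [b] = some c := by
  cases s <;> simp [children, subtree, eq_comm]

lemma Node.exists_child {x : t.Node} {c : LabTree N T} (hc : c ∈ x.tree.children) :
    ∃ y : t.Node, x.IsChild y ∧ y.tree = c := by
  obtain ⟨b, hb⟩ := mem_children_iff.1 hc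
  have h : t.subtree (x.1 ++ [b]) = some c := by rw [subtree_append, x.subtree_eq]; exact hb
  exact ⟨⟨x.1 ++ [b], by simp [h]⟩, ⟨b, rfl⟩, Node.tree_eq h⟩

lemma Node.IsChild.tree_mem {x y : t.Node} (h : x.IsChild y) : y.tree ∈ x.tree.children := by
  obtain ⟨b, hb⟩ := h
  refine mem_children_iff.2 ⟨b, ?_⟩
  have := y.subtree_eq
  rwa [hb, subtree_append, x.subtree_eq] at this

lemma Node.exists_parent (x : t.Node) : x.tree = t ∨ ∃ y : t.Node, y.IsChild x := by
  obtain ⟨p, hp⟩ := x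
  rcases List.eq_nil_or_concat p with rfl | ⟨q, b, rfl⟩
  · exact Or.inl (Node.tree_eq (by simp [subtree]))
  · refine Or.inr ⟨⟨q, ?_⟩, b, by simp⟩
    rw [List.concat_eq_append, subtree_append] at hp
    by_contra h
    simp only [Option.not_isSome_iff_eq_none] at h
    simp [h] at hp

lemma NoShallow.of_node {rk : N → ℕ} {n : ℕ → ℕ} {l q : ℕ} (h : t.NoShallow rk n l q)
    (x : t.Node) : ∃ q', x.tree.NoShallow rk n l q' := by
  induction hm : x.1.length generalizing x with
  | zero =>
    rcases x.exists_parent with hx | ⟨y, b, hb⟩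
    · exact ⟨q, by rw [hx]; exact h⟩
    · simp [hb] at hm
  | succ m ih =>
    rcases x.exists_parent with hx | ⟨y, hy⟩
    · exact ⟨q, by rw [hx]; exact h⟩
    · have hy' := hy
      obtain ⟨b, hb⟩ := hy'
      obtain ⟨q', hq'⟩ := ih y (by simpa [hb] using hm)
      exact ⟨_, (noShallow_iff.1 hq').2 _ hy.tree_mem⟩

lemma NoShallow.reaches {rk : N → ℕ} {n : ℕ → ℕ} {l q : ℕ} (h : t.NoShallow rk n l q)
    {x y : t.Node} (hxy : x.IsChild y) (hl : l ≤ rk y.label) (hlt : rk x.label < rk y.label) :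
    y.tree.Reaches rk (rk y.label) (n (rk y.label)) := by
  obtain ⟨q', hq'⟩ := h.of_node x
  exact (noShallow_iff.1 ((noShallow_iff.1 hq').2 _ hxy.tree_mem)).1 hl hlt

end LabTree

/-! ### Heavy walks to a matryoshka -/

namespace DCFG

open LabTree

variable {T : Type u} {k : ℕ} (G : DCFG.{u, v} T k) {t : LabTree G.NT T}

/-- Two nodes are joined by a walk of length at most `m` through nodes of rank at least `l`. -/
def HeavilyJoined (l m : ℕ) (x y : t.Node) : Prop :=
  ∃ p : t.graph.Walk x y, (∀ z ∈ p.support, l ≤ G.nodeRank z) ∧ p.length ≤ m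

variable {G} {l l' m m' : ℕ} {x y z : t.Node}

lemma HeavilyJoined.refl (h : l ≤ G.nodeRank x) : G.HeavilyJoined l m x x :=
  ⟨.nil, by simpa using h, Nat.zero_le _⟩

lemma HeavilyJoined.cons (hx : l ≤ G.nodeRank x) (hxy : t.graph.Adj x y)
    (h : G.HeavilyJoined l m y z) : G.HeavilyJoined l (m + 1) x z := by
  obtain ⟨p, h1, h2⟩ := h
  refine ⟨.cons hxy p, ?_, by simpa using h2⟩
  simpa [hx] using h1

lemma HeavilyJoined.trans (h : G.HeavilyJoined l m x y) (h' : G.HeavilyJoined l m' y z) :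
    G.HeavilyJoined l (m + m') x z := by
  obtain ⟨p, h1, h2⟩ := h
  obtain ⟨p', h1', h2'⟩ := h'
  refine ⟨p.append p', fun a ha => ?_, by rw [SimpleGraph.Walk.length_append]; omega⟩
  exact ((SimpleGraph.Walk.mem_support_append_iff _ _).1 ha).elim (h1 a) (h1' a)

lemma HeavilyJoined.mono (h : G.HeavilyJoined l m x y) (hl : l' ≤ l) (hm : m ≤ m') :
    G.HeavilyJoined l' m' x y :=
  h.imp fun _ h => ⟨fun z hz => hl.trans (h.1 z hz), h.2.trans hm⟩

/-- Walks are convenient for composition; cutting out loops neither lengthens a walk nor adds nodes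
to it. -/
lemma HeavilyJoined.exists_path (h : G.HeavilyJoined l m x y) :
    ∃ p : t.graph.Path x y, G.IsHeavy l p ∧ p.1.length ≤ m := by
  classical
  obtain ⟨p, h1, h2⟩ := h
  exact ⟨p.toPath, fun z hz => h1 z (p.support_bypass_subset_support hz),
    p.length_bypass_le_length.trans h2⟩

/-- Going up from a node of positive rank. -/
lemma exists_chain_or_ancestor (ht : G.rk t.label = 0) (hx : 0 < G.nodeRank x) (j : ℕ) :
    (∃ c : List t.Node, (c ++ [x]).IsChain Node.IsChild ∧
      (∀ y ∈ c, G.nodeRank y = G.nodeRank x) ∧ c.length = j) ∨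
    ∃ s : t.Node, G.HeavilyJoined (G.nodeRank x) j x s ∧ G.nodeRank s = G.nodeRank x ∧
      ∃ y : t.Node, y.IsChild s ∧ G.nodeRank y ≠ G.nodeRank x := by
  induction j generalizing x with
  | zero => exact Or.inl ⟨[], by simp, by simp, rfl⟩
  | succ j ih =>
    rcases x.exists_parent with h | ⟨y, hy⟩
    · have : G.nodeRank x = G.rk t.label := congrArg (fun s : LabTree G.NT T => G.rk s.label) h
      omega
    · by_cases hr : G.nodeRank y = G.nodeRank x
      · rcases ih (x := y) (by omega) with ⟨c, h1, h2, h3⟩ | ⟨s, h1, h2, h3⟩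
        · refine Or.inl ⟨c ++ [y], ?_, ?_, by simp [h3]⟩
          · rw [List.isChain_append]
            exact ⟨h1, by simp, by simpa using hy⟩
          · intro z hz
            rcases List.mem_append.1 hz with hz | hz
            · exact (h2 z hz).trans hr
            · obtain rfl := List.mem_singleton.1 hz
              exact hr
        · rw [hr] at h1 h2 h3
          exact Or.inr ⟨s, .cons le_rfl (Or.inr hy) h1, h2, h3⟩
      · exact Or.inr ⟨x, .refl le_rfl, rfl, y, hy, hr⟩

/-- Going down from a node. -/
lemma exists_chain_or_descendant {n : ℕ} (h : x.tree.Reaches G.rk (G.nodeRank x) n) :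
    (∃ c : List t.Node, (x :: c).IsChain Node.IsChild ∧
      (∀ y ∈ c, G.nodeRank y = G.nodeRank x) ∧ c.length = n) ∨
    ∃ y : t.Node, G.HeavilyJoined (G.nodeRank x) n x y ∧ G.nodeRank x < G.nodeRank y := by
  induction n generalizing x with
  | zero => exact Or.inl ⟨[], by simp, by simp, rfl⟩
  | succ n ih =>
    obtain ⟨s, hs, h⟩ := h
    obtain ⟨y, hxy, rfl⟩ := Node.exists_child hs
    rcases h with h | ⟨hr, h⟩
    · exact Or.inr ⟨y, .cons le_rfl (Or.inl hxy) (.refl (show _ ≤ G.rk y.tree.label from h.le)), h⟩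
    · change G.nodeRank y = G.nodeRank x at hr
      rw [← hr] at h
      rcases ih h with ⟨c, h1, h2, h3⟩ | ⟨z, h1, h2⟩
      · refine Or.inl ⟨y :: c, List.isChain_cons_cons.2 ⟨hxy, h1⟩, ?_, by simp [h3]⟩
        simpa [hr] using h2
      · rw [hr] at h1 h2
        exact Or.inr ⟨z, .cons le_rfl (Or.inl hxy) h1, h2⟩

lemma numNT_le (r : ℕ) : G.numNT r ≤ Nat.card G.NT :=
  have := G.finite_NT
  Finite.card_subtype_le _

/-- Induction on the room `d` left for the rank to grow. One round consists of at most N steps up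
and then at most N steps down or a single step to a parent of larger rank, N being the number of all
nonterminals; so each round costs at most 2N + 1. -/
lemma exists_heavilyJoined_matryoshka (ht : G.rk t.label = 0) {q : ℕ}
    (hn : t.NoShallow G.rk G.numNT 1 q) (d : ℕ) (x : t.Node) (hx : 0 < G.nodeRank x)
    (hd : k < G.nodeRank x + d) :
    ∃ l, G.nodeRank x ≤ l ∧ ∃ c : List t.Node, G.IsMatryoshka t l c ∧
      ∃ y ∈ c, G.HeavilyJoined (G.nodeRank x) (d * (2 * Nat.card G.NT + 1)) x y := by
  induction d generalizing x with
  | zero =>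
    have : G.nodeRank x ≤ k := G.rk_le _
    omega
  | succ d ih =>
    set N := Nat.card G.NT
    have hN : G.numNT (G.nodeRank x) ≤ N := numNT_le _
    -- it suffices to reach a node of larger rank
    have higher : ∀ y m, m ≤ 2 * N + 1 → G.HeavilyJoined (G.nodeRank x) m x y →
        G.nodeRank x < G.nodeRank y →
        ∃ l, G.nodeRank x ≤ l ∧ ∃ c : List t.Node, G.IsMatryoshka t l c ∧
        ∃ y ∈ c, G.HeavilyJoined (G.nodeRank x) ((d + 1) * (2 * N + 1)) x y := by
      intro y m hm hxy hr
      obtain ⟨l, hl, c, hc, z, hz, hyz⟩ := ih y (by omega) (by omega)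
      refine ⟨l, hr.le.trans hl, c, hc, z, hz, ?_⟩
      exact (hxy.trans (hyz.mono hr.le le_rfl)).mono le_rfl (by rw [add_mul d 1, one_mul]; omega)
    rcases exists_chain_or_ancestor ht hx (G.numNT (G.nodeRank x)) with
      ⟨c, h1, h2, h3⟩ | ⟨s, h1, h2, y, h3, h4⟩
    · refine ⟨_, le_rfl, c ++ [x], ⟨h1, ?_, by simp [h3]⟩, x, by simp, .refl le_rfl⟩
      intro z hz
      rcases List.mem_append.1 hz with hz | hz
      · exact h2 z hz
      · rw [List.mem_singleton.1 hz]
    rcases h4.lt_or_gt with h4 | h4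
    -- The parent of `s` has smaller rank, so `s` is the root of a component, which is not shallow.
    · have hs : s.tree.Reaches G.rk (G.nodeRank s) (G.numNT (G.nodeRank s)) :=
        hn.reaches h3 (by change 1 ≤ G.nodeRank s; omega)
          (by change G.nodeRank y < G.nodeRank s; omega)
      rcases exists_chain_or_descendant hs with ⟨c, c1, c2, c3⟩ | ⟨z, c1, c2⟩
      · refine ⟨_, le_rfl, s :: c, ⟨c1, ?_, by simp [c3, h2]⟩, s, by simp,
          h1.mono le_rfl (by rw [add_mul d 1, one_mul]; omega)⟩
        simpa [h2] using c2
      · rw [h2] at c1 c2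
        exact higher z _ (by omega) (h1.trans c1) c2
    · refine higher y _ ?_ (h1.trans (.cons h2.ge (Or.inr h3) (.refl (m := 0) h4.le))) h4
      omega

end DCFG

end Displacement

/-! ### The grammar of all sound rules -/

namespace Displacement

open LabTree RankedLanguage

variable {T : Type u} {k : ℕ}

/-- The grammar in Chomsky normal form with all rules that are sound for the given assignment of
languages to nonterminals. -/
def DCFG.ofLanguages [Finite T] {N : Type v} [Finite N] (lab : N → RankedLanguage T) (S : N)
    (hk : ∀ A, (lab A).rk ≤ k) (hS : (lab S).rk = 0) : DCFG.{u, v} T k where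
  NT := N
  finite_NT := inferInstance
  rk A := (lab A).rk
  rk_le := hk
  start := S
  rk_start := hS
  rules := {p |
    (∃ A B C, B ≠ S ∧ C ≠ S ∧ (lab A).rk = (lab B).rk + (lab C).rk ∧
      (∀ x ∈ (lab B).lang, ∀ y ∈ (lab C).lang, x ++ y ∈ (lab A).lang) ∧
      p = (A, .concat (.nt B) (.nt C))) ∨
    (∃ A j B C, B ≠ S ∧ C ≠ S ∧ (lab A).rk + 1 = (lab B).rk + (lab C).rk ∧
      (1 ≤ j ∧ j ≤ (lab B).rk) ∧
      (∀ x ∈ (lab B).lang, ∀ y ∈ (lab C).lang, intercalate j x y ∈ (lab A).lang) ∧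
      p = (A, .wrap j (.nt B) (.nt C))) ∨
    (∃ A a, [some a] ∈ (lab A).lang ∧ p = (A, .word [a])) ∨
    (∃ A, [none] ∈ (lab A).lang ∧ p = (A, .sep)) ∨
    ([] ∈ (lab S).lang ∧ p = (S, .word []))}
  finite_rules := by
    refine ((Set.finite_range fun q : N × N × N =>
      (q.1, Term.concat (T := T) (.nt q.2.1) (.nt q.2.2))).union <|
      (Set.finite_range fun q : N × Fin (k + 1) × N × N =>
      (q.1, Term.wrap (T := T) q.2.1 (.nt q.2.2.1) (.nt q.2.2.2))).union <|
      (Set.finite_range fun q : N × T => (q.1, Term.word [q.2])).union <|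
      (Set.finite_range fun A : N => (A, Term.sep)).union <|
      Set.finite_singleton (S, Term.word [])).subset ?_
    rintro _ (⟨A, B, C, -, -, -, -, rfl⟩ | ⟨A, j, B, C, -, -, -, ⟨-, hj⟩, -, rfl⟩ |
      ⟨A, a, -, rfl⟩ | ⟨A, -, rfl⟩ | ⟨-, rfl⟩)
    · exact Or.inl ⟨(A, B, C), rfl⟩
    · exact Or.inr (Or.inl ⟨(A, ⟨j, Nat.lt_succ_of_le (hj.trans (hk B))⟩, B, C), rfl⟩)
    · exact Or.inr (Or.inr (Or.inl ⟨(A, a), rfl⟩))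
    · exact Or.inr (Or.inr (Or.inr (Or.inl ⟨A, rfl⟩)))
    · exact Or.inr (Or.inr (Or.inr (Or.inr rfl)))
  correct_rules := by
    rintro _ _ (⟨A, B, C, -, -, h, -, h'⟩ | ⟨A, j, B, C, -, -, h, ⟨h1, h2⟩, -, h'⟩ |
      ⟨A, a, -, h'⟩ | ⟨A, -, h'⟩ | ⟨-, h'⟩) <;> cases h'
    · exact ⟨hk B, hk C, h.symm.trans_le (hk _)⟩
    · exact ⟨hk B, hk C, h1, h2.trans (hk B),
        h.symm.trans_le (Nat.succ_le_succ (hk _)), h2⟩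
    all_goals trivial
  rank_rules := by
    rintro _ _ (⟨A, B, C, -, -, h, -, h'⟩ | ⟨A, j, B, C, -, -, h, -, -, h'⟩ |
      ⟨A, a, h, h'⟩ | ⟨A, h, h'⟩ | ⟨h, h'⟩) <;> cases h'
    · exact h.symm
    · exact Nat.sub_eq_of_eq_add h.symm
    · exact (lab _).seps_eq _ h
    · exact (lab _).seps_eq _ h
    · exact hS.symm

namespace DCFG

lemma IsDerivationTree.yields {G : DCFG.{u, v} T k} {t : LabTree G.NT T}
    (h : G.IsDerivationTree t) : G.Yields (.nt t.label) t.value := by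
  induction t with
  | leaf A x =>
    obtain ⟨h, ⟨w, rfl⟩ | rfl⟩ := h
    · exact .nt h (.word w)
    · exact .nt h .sep
  | concat A s t ihs iht => exact .nt h.1 (.concat (ihs h.2.1) (iht h.2.2))
  | wrap A j s t ihs iht => exact .nt h.1 (.wrap (ihs h.2.1) (iht h.2.2))

variable [Finite T] {N : Type v} [Finite N] {lab : N → RankedLanguage T} {S : N}
  {hk : ∀ A, (lab A).rk ≤ k} {hS : (lab S).rk = 0}

lemma isChomsky_ofLanguages : (ofLanguages lab S hk hS).IsChomsky := by
  rintro _ _ (⟨A, B, C, hB, hC, -, -, h⟩ | ⟨A, j, B, C, hB, hC, -, -, -, h⟩ |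
    ⟨A, a, -, h⟩ | ⟨A, -, h⟩ | ⟨-, h⟩) <;> cases h
  · exact Or.inl ⟨B, C, hB, hC, rfl⟩
  · exact Or.inr (Or.inl ⟨j, B, C, hB, hC, rfl⟩)
  · exact Or.inr (Or.inr (Or.inl ⟨a, rfl⟩))
  · exact Or.inr (Or.inr (Or.inr (Or.inl rfl)))
  · exact Or.inr (Or.inr (Or.inr (Or.inr ⟨rfl, rfl⟩)))

/-- The set of values of a term under an assignment of languages to nonterminals. -/
def denote (lab : N → RankedLanguage T) : Term N T → Set (SepWord T)
  | .nt A => (lab A).lang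
  | .word w => {w.map some}
  | .sep => {[none]}
  | .concat α β => Set.image2 (· ++ ·) (denote lab α) (denote lab β)
  | .wrap j α β => Set.image2 (intercalate j) (denote lab α) (denote lab β)

/-- The assigned languages form a model of the rules, so they contain everything that is derivable.
-/
lemma Yields.mem_denote {α : Term (ofLanguages lab S hk hS).NT T} {w : SepWord T}
    (h : (ofLanguages lab S hk hS).Yields α w) : w ∈ denote (N := N) lab α := by
  induction h with
  | nt hA _ ih =>
    rcases hA with ⟨A, B, C, -, -, -, hl, h⟩ | ⟨A, j, B, C, -, -, -, -, hl, h⟩ |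
      ⟨A, a, hl, h⟩ | ⟨A, hl, h⟩ | ⟨hl, h⟩ <;> cases h
    · obtain ⟨x, hx, y, hy, rfl⟩ := ih
      exact hl x hx y hy
    · obtain ⟨x, hx, y, hy, rfl⟩ := ih
      exact hl x hx y hy
    all_goals
      obtain rfl := ih
      exact hl
  | word w => rfl
  | sep => rfl
  | concat _ _ ihα ihβ => exact Set.mem_image2_of_mem ihα ihβ
  | wrap _ _ ihα ihβ => exact Set.mem_image2_of_mem ihα ihβ

/-- Languages are renamed to the nonterminals that stand for them. `Reaches` and `NoShallow` depend
only on ranks and on the shape of the tree, and the renaming changes neither. -/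
lemma exists_isDerivationTree {F : Set (RankedLanguage T)} {f : RankedLanguage T → N}
    (hf : ∀ A ∈ F, lab (f A) = A) (hfS : ∀ A ∈ F, f A ≠ S) {n : ℕ → ℕ} {l : ℕ}
    {t : LabTree (RankedLanguage T) T} (ht : t.Sound F) {q : ℕ}
    (hn : t.NoShallow RankedLanguage.rk n l q) :
    ∃ t' : LabTree N T, (ofLanguages lab S hk hS).IsDerivationTree t' ∧
      t'.label = f t.label ∧ t'.value = t.value ∧ t'.NoShallow (fun A => (lab A).rk) n l q ∧
      ∀ r m, t.Reaches RankedLanguage.rk r m → t'.Reaches (fun A => (lab A).rk) r m := by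
  have rebuild : ∀ (t a b : LabTree (RankedLanguage T) T) (t' a' b' : LabTree N T) (q : ℕ),
      t.children = [a, b] → t'.children = [a', b'] → (lab t'.label).rk = t.label.rk →
      (lab a'.label).rk = a.label.rk → (lab b'.label).rk = b.label.rk →
      t.NoShallow RankedLanguage.rk n l q →
      a'.NoShallow (fun A => (lab A).rk) n l t.label.rk →
      b'.NoShallow (fun A => (lab A).rk) n l t.label.rk →
      (∀ r m, a.Reaches RankedLanguage.rk r m → a'.Reaches (fun A => (lab A).rk) r m) →
      (∀ r m, b.Reaches RankedLanguage.rk r m → b'.Reaches (fun A => (lab A).rk) r m) →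
      t'.NoShallow (fun A => (lab A).rk) n l q ∧
      ∀ r m, t.Reaches RankedLanguage.rk r m → t'.Reaches (fun A => (lab A).rk) r m := by
    intro t a b t' a' b' q ht ht' hlab ha hb hn hna hnb hra hrb
    have hr : ∀ r m, t.Reaches RankedLanguage.rk r m →
        t'.Reaches (fun A => (lab A).rk) r m := by
      intro r m h
      cases m with
      | zero => trivial
      | succ m =>
        obtain ⟨c, hc, h⟩ := h
        rw [ht] at hc
        simp only [List.mem_cons, List.not_mem_nil, or_false] at hc
        rcases hc with rfl | rfl
        · exact ⟨a', by simp [ht'], h.imp (fun h => h.trans_eq ha.symm)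
            fun h => ⟨ha.trans h.1, hra r m h.2⟩⟩
        · exact ⟨b', by simp [ht'], h.imp (fun h => h.trans_eq hb.symm)
            fun h => ⟨hb.trans h.1, hrb r m h.2⟩⟩
    refine ⟨noShallow_iff.2 ⟨fun h1 h2 => ?_, ?_⟩, hr⟩
    · simp only [hlab] at h1 h2 ⊢
      exact hr _ _ ((noShallow_iff.1 hn).1 h1 h2)
    · simp [ht', hlab, hna, hnb]
  have hchildn := fun {t : LabTree (RankedLanguage T) T} {q : ℕ}
    (hn : t.NoShallow RankedLanguage.rk n l q) => (noShallow_iff.1 hn).2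
  induction t generalizing q with
  | leaf A x =>
    obtain ⟨hA, hx, hxA⟩ := ht
    have hr : ∀ (y : Term N T) r m, (leaf A x).Reaches RankedLanguage.rk r m →
        (leaf (f A) y).Reaches (fun A => (lab A).rk) r m := by
      intro y r m h
      cases m with
      | zero => trivial
      | succ m => obtain ⟨c, hc, -⟩ := h; simp [children] at hc
    have hn' : ∀ y : Term N T, (leaf (f A) y).NoShallow (fun A => (lab A).rk) n l q := by
      intro y h1 h2
      simp only [hf A hA] at h1 h2 ⊢
      exact hr y _ _ (hn h1 h2)
    rcases hx with ⟨a, rfl⟩ | rfl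
    · refine ⟨leaf (f A) (.word [a]), ⟨Or.inr (Or.inr (Or.inl ⟨f A, a, ?_, rfl⟩)),
        Or.inl ⟨_, rfl⟩⟩, rfl, rfl, hn' _, hr _⟩
      rwa [hf A hA]
    · refine ⟨leaf (f A) .sep, ⟨Or.inr (Or.inr (Or.inr (Or.inl ⟨f A, ?_, rfl⟩))),
        Or.inr rfl⟩, rfl, rfl, hn' _, hr _⟩
      rwa [hf A hA]
  | concat A a b iha ihb =>
    obtain ⟨hA, hrk, hl, ha, hb⟩ := ht
    obtain ⟨a', a1, a2, a3, a4, a5⟩ := iha ha (hchildn hn a (by simp [children]))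
    obtain ⟨b', b1, b2, b3, b4, b5⟩ := ihb hb (hchildn hn b (by simp [children]))
    have ea := hf _ ha.label_mem
    have eb := hf _ hb.label_mem
    refine ⟨.concat (f A) a' b', ⟨Or.inl ⟨f A, a'.label, b'.label, ?_, ?_, ?_, ?_, rfl⟩, a1, b1⟩,
      rfl, by simp [a3, b3], rebuild _ a b _ a' b' q rfl rfl ?_ ?_ ?_ hn a4 b4 a5 b5⟩
    · rw [a2]; exact hfS _ ha.label_mem
    · rw [b2]; exact hfS _ hb.label_mem
    · rw [a2, b2, ea, eb, hf A hA]; exact hrk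
    · rw [a2, b2, ea, eb, hf A hA]; exact hl
    · simp [hf A hA]
    · rw [a2, ea]
    · rw [b2, eb]
  | wrap A j a b iha ihb =>
    obtain ⟨hA, hrk, hj, hl, ha, hb⟩ := ht
    obtain ⟨a', a1, a2, a3, a4, a5⟩ := iha ha (hchildn hn a (by simp [children]))
    obtain ⟨b', b1, b2, b3, b4, b5⟩ := ihb hb (hchildn hn b (by simp [children]))
    have ea := hf _ ha.label_mem
    have eb := hf _ hb.label_mem
    refine ⟨.wrap (f A) j a' b',
      ⟨Or.inr (Or.inl ⟨f A, j, a'.label, b'.label, ?_, ?_, ?_, ?_, ?_, rfl⟩), a1, b1⟩,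
      rfl, by simp [a3, b3], rebuild _ a b _ a' b' q rfl rfl ?_ ?_ ?_ hn a4 b4 a5 b5⟩
    · rw [a2]; exact hfS _ ha.label_mem
    · rw [b2]; exact hfS _ hb.label_mem
    · rw [a2, b2, ea, eb, hf A hA]; exact hrk
    · rw [a2, ea]; exact hj
    · rw [a2, b2, ea, eb, hf A hA]; exact hl
    · simp [hf A hA]
    · rw [a2, ea]
    · rw [b2, eb]

/-- The start symbol must not occur on right-hand sides, so it is a separate symbol that replaces
the label at the root only. -/
lemma IsDerivationTree.relabel_start {t : LabTree N T}
    (h : (ofLanguages lab S hk hS).IsDerivationTree t) (hr : (lab t.label).rk = 0)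
    (hl : (lab t.label).lang ⊆ (lab S).lang) :
    (ofLanguages lab S hk hS).IsDerivationTree (t.relabel S) := by
  cases t with
  | leaf A x =>
    refine ⟨?_, h.2⟩
    rcases h.1 with ⟨A, B, C, -, -, -, -, e⟩ | ⟨A, j, B, C, -, -, -, -, -, e⟩ |
      ⟨A, a, h', e⟩ | ⟨A, h', e⟩ | ⟨h', e⟩ <;> cases e
    · exact h.2.elim (fun ⟨w, e⟩ => by cases e) (fun e => by cases e)
    · exact h.2.elim (fun ⟨w, e⟩ => by cases e) (fun e => by cases e)
    · exact Or.inr (Or.inr (Or.inl ⟨S, a, hl h', rfl⟩))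
    · exact Or.inr (Or.inr (Or.inr (Or.inl ⟨S, hl h', rfl⟩)))
    · exact Or.inr (Or.inr (Or.inr (Or.inr ⟨h', rfl⟩)))
  | concat A s t =>
    refine ⟨?_, h.2⟩
    rcases h.1 with ⟨A, B, C, hB, hC, e1, e2, e⟩ | ⟨A, j, B, C, -, -, -, -, -, e⟩ |
      ⟨A, a, h', e⟩ | ⟨A, h', e⟩ | ⟨h', e⟩ <;> cases e
    exact Or.inl ⟨S, _, _, hB, hC, by rw [hS, ← e1]; exact hr.symm,
      fun x hx y hy => hl (e2 x hx y hy), rfl⟩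
  | wrap A j s t =>
    refine ⟨?_, h.2⟩
    rcases h.1 with ⟨A, B, C, hB, hC, e1, e2, e⟩ | ⟨A, j, B, C, hB, hC, e1, e2, e3, e⟩ |
      ⟨A, a, h', e⟩ | ⟨A, h', e⟩ | ⟨h', e⟩ <;> cases e
    exact Or.inr (Or.inl ⟨S, j, _, _, hB, hC, by rw [hS, ← e1]; exact congrArg (· + 1) hr.symm,
      e2, fun x hx y hy => hl (e3 x hx y hy), rfl⟩)

end DCFG

/-- Finite families of languages together with one additional symbol can be indexed by a type in
any universe. -/
lemma exists_labelling {F : Set (RankedLanguage T)} (hF : F.Finite) (L : RankedLanguage T) :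
    ∃ (N : Type v) (_ : Finite N) (lab : N → RankedLanguage T) (S : N)
      (f : RankedLanguage T → N), lab S = L ∧ (∀ A ∈ F, lab (f A) = A ∧ f A ≠ S) ∧
      ∀ B ≠ S, lab B ∈ F ∧ f (lab B) = B := by
  classical
  have := hF.to_subtype
  let e : Option F ≃ ULift.{v} (Fin (Nat.card (Option F))) :=
    (Finite.equivFin (Option F)).trans Equiv.ulift.symm
  refine ⟨_, inferInstance, fun B => (e.symm B).elim L Subtype.val, e none,
    fun A => e (if h : A ∈ F then some ⟨A, h⟩ else none), by simp, ?_, ?_⟩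
  · intro A hA
    simp [hA]
  · intro B hB
    obtain ⟨C, rfl⟩ := e.surjective B
    cases C with
    | none => exact absurd rfl hB
    | some C => simp

end Displacement

theorem mainTheorem3 {T : Type u} [Finite T] (k : ℕ) (G : Displacement.DCFG.{u, v} T k) :
    ∃ (m : ℕ) (G' : Displacement.DCFG.{u, v} T k),
      G'.language = G.language ∧ G'.IsCompact m := by
  open Displacement Displacement.DCFG in
  obtain ⟨F, hF, hFk, A₀, hA₀, hA₀r, hA₀L, hgen⟩ := G.generatedWithoutShallow (Nat.zero_le k)
  have hL0 : ∀ w ∈ G.language, seps w = 0 := fun w hw =>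
    ((mem_languageOf_iff.1 hw).seps_eq (G.rk_le G.start)).trans G.rk_start
  obtain ⟨N, hN, lab, S, f, hS, hf, hlab⟩ :=
    exists_labelling.{u, v} hF ⟨0, G.language, hL0⟩
  have hk : ∀ A, (lab A).rk ≤ k := by
    intro A
    by_cases hA : A = S
    · rw [hA, hS]; exact Nat.zero_le k
    · exact hFk _ (hlab A hA).1
  have hS0 : (lab S).rk = 0 := by rw [hS]
  have hSl : (lab S).lang = G.language := by rw [hS]
  let G' : DCFG.{u, v} T k := ofLanguages lab S hk hS0
  -- The additional start symbol has rank 0 and does not affect the counts in positive ranks.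
  have hnum : ∀ r, 0 + 1 ≤ r → rankCount F r = G'.numNT r := by
    intro r hr
    have himage : {A ∈ F | A.rk = r} = lab '' {B | (lab B).rk = r} := by
      ext A
      constructor
      · rintro ⟨hA, hAr⟩
        exact ⟨f A, by simpa [(hf A hA).1] using hAr, (hf A hA).1⟩
      · rintro ⟨B, hB, rfl⟩
        refine ⟨(hlab B ?_).1, hB⟩
        rintro rfl
        have : (lab B).rk = r := hB
        omega
    have hne : ∀ B, (lab B).rk = r → B ≠ S := by
      rintro B hB rfl
      omega
    rw [rankCount, himage, Set.InjOn.ncard_image]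
    · rfl
    · intro B hB C hC h
      rw [← (hlab B (hne B hB)).2, h, (hlab C (hne C hC)).2]
  have hsound : ∀ w ∈ G'.language, w ∈ G.language := by
    intro w hw
    have : w ∈ (lab S).lang := (mem_languageOf_iff.1 hw).mem_denote
    rwa [hSl] at this
  have hcomplete : ∀ w ∈ G.language, ∃ t : LabTree N T, G'.IsDerivationTreeOf t w ∧
      t.NoShallow G'.rk G'.numNT 1 0 := by
    intro w hw
    -- The empty word is derived by S → ε; its one-node tree has no node of positive rank.
    by_cases hw0 : w = []
    · subst hw0
      refine ⟨.leaf S (.word []), ⟨⟨Or.inr (Or.inr (Or.inr (Or.inr ⟨?_, rfl⟩))),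
        Or.inl ⟨_, rfl⟩⟩, rfl, rfl⟩, fun h => ?_⟩
      · rwa [hSl]
      · have : (lab S).rk ≥ 1 := h
        omega
    · obtain ⟨t, h1, h2, h3, h4⟩ := hgen w hw hw0
      obtain ⟨t', t1, t2, t3, t4, -⟩ := exists_isDerivationTree (hk := hk) (hS := hS0)
        (fun A hA => (hf A hA).1) (fun A hA => (hf A hA).2) h1 h4
      have e : lab t'.label = A₀ := by rw [t2, h2, (hf A₀ hA₀).1]
      refine ⟨t'.relabel S, ⟨t1.relabel_start (by rw [e, hA₀r]) (by rwa [e, hSl]),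
        LabTree.label_relabel S t', (LabTree.value_relabel S t').trans (t3.trans h3)⟩, ?_⟩
      exact (t4.congr hnum).relabel (by rw [e, hA₀r, hS0])
  have hlang : G'.language = G.language := by
    refine Set.Subset.antisymm hsound fun w hw => ?_
    obtain ⟨t, ⟨h1, h2, h3⟩, -⟩ := hcomplete w hw
    have := h1.yields
    rw [h2] at this
    rw [← h3]
    exact mem_languageOf_iff.2 this
  -- With `k + 1` rounds the condition `k < G.nodeRank x + d` holds for every node.
  refine ⟨(k + 1) * (2 * Nat.card G'.NT + 1), G', hlang, isChomsky_ofLanguages, fun w hw => ?_⟩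
  obtain ⟨t, ht, hn⟩ := hcomplete w (hsound w hw)
  refine ⟨t, ht, fun x hx => ?_⟩
  obtain ⟨l, hl, c, hc, y, hy, hxy⟩ := exists_heavilyJoined_matryoshka
    (by rw [ht.2.1]; exact hS0) hn (k + 1) x hx (by omega)
  exact ⟨l, hl, c, hc, y, hy, hxy.exists_path⟩
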